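/- Let $(\Omega,\mathcal F,\mathbb P)$ be a probability space and let $(W_t)_{t\in\mathbb R}$ be a complex Brownian motion on it indexed by the whole real line: its increments over disjoint intervals are independent, $W_t-W_s$ (for $s\le t$) is a centred circular complex Gaussian variable with $\mathbb E|W_t-W_s|^2=t-s$, and its paths are almost surely continuous. For $N\ge 1$ and $R\in\mathbb N$ put $$\varphi_{N,R}(\omega,x)=\sum_{k=-NR}^{NR-1}\bigl(W_{(k+1)/N}-W_{k/N}\bigr)(\omega)\,\frac{1}{\sqrt{1+k^2/N^2}}\,e^{ikx/N}.$$ Let $D^s=(1-\partial_x^2)^{s/2}$, acting on tempered distributions as the Fourier multiplier $(1+n^2)^{s/2}$, and let $H^{1/2-}_{\rm loc}$ be the space of the tempered distributions $u$ on $\mathbb R$ such that $p_{R,s}(u)=\bigl(\int_{-R}^{R}|D^su|^2\,dx\bigr)^{1/2}<\infty$ for all $R>0$ and $s<1/2$, with the topology induced by the seminorms $p_{R,1/2-1/l}$ ($R,l\ge 1$ integers) and its Borel $\sigma$-algebra. Let $\varphi=\lim_{R\to\infty}\varphi_R$, where $\varphi_R=\lim_{n\to\infty}\varphi_{2^n,R}$,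 both limits being taken in the norm $\operatorname{ess\,sup}_{x\in\mathbb R}(1+x^2)^{-1/2}\|f(\cdot,x)\|_{L^2(\Omega)}$. Then the random field $\varphi$ exists, it defines a random variable with values in $H^{1/2-}_{\rm loc}$, and for every version of this random variable: 1. for $\mathbb P$-almost every $\omega$, $\varphi(\omega)$ does not belong to $L^2(\mathbb R)$; 2. the law $\mu$ of $\varphi$ on $H^{1/2-}_{\rm loc}$ satisfies $\mu(L^2(\mathbb R)\cap H^{1/2-}_{\rm loc})=0$; 3. for every measurable $\chi:\mathbb R\to\mathbb R$ such that $0\le\chi(x)\le C(1+x^2)^{-3\alpha/2}$ for all $x$, with some constants $C$ and $\alpha>1$, the Gibbs measure $$d\rho(u)=\frac{1}{\Gamma}\,e^{-\frac1{4\pi}\int_{\mathbb R}\chi|\mathrm{Re}\,u|^4}\,d\mu(u),\qquad \Gamma=\int e^{-\frac1{4\pi}\int_{\mathbb R}\chi|\mathrm{Re}\,u|^4}\,d\mu(u),$$ satisfies $\rho(L^2(\mathbb R)\cap H^{1/2-}_{\rm loc})=0$. -/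

import Mathlib

open MeasureTheory ProbabilityTheory Filter Topology
open scoped SchwartzMap NNReal ENNReal

noncomputable section

namespace KleinGordon

/-! ### The operators `D ^ s` and functions that are locally square integrable -/

/-- The symbol of `D ^ s = (1 - Δ) ^ (s / 2)`. With the convention `e ^ (-2πi x ξ)` for the Fourier
transform, the frequency `n` of the plane wave `e ^ (i n x)` is `n = 2 π ξ`, so the symbol
`(1 + n ^ 2) ^ (s / 2)` reads as follows. -/
def symbol (s : ℝ) (ξ : ℝ) : ℂ := (((1 + (2 * Real.pi * ξ) ^ 2) ^ (s / 2) : ℝ) : ℂ)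

/-- The symbol has temperate growth, so that the multiplier below is not a junk value. -/
theorem symbol_hasTemperateGrowth (s : ℝ) : (symbol s).HasTemperateGrowth := by
  have h1 : (fun x : ℝ ↦ (1 + ‖x‖ ^ 2) ^ (s / 2)).HasTemperateGrowth := by fun_prop
  have h2 : (fun ξ : ℝ ↦ (2 * Real.pi) * ξ).HasTemperateGrowth := by fun_prop
  have h3 : Complex.ofReal.HasTemperateGrowth := by fun_prop
  have h4 := h3.comp (h1.comp h2)
  convert h4 using 1
  funext ξ
  simp [symbol, Function.comp_def, mul_pow]

/-- `D ^ s = (1 - Δ) ^ (s / 2)` on tempered distributions. -/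
def fracD (s : ℝ) : 𝓢'(ℝ, ℂ) →L[ℂ] 𝓢'(ℝ, ℂ) :=
  TemperedDistribution.fourierMultiplierCLM ℂ (symbol s)

theorem fracD_zero (T : 𝓢'(ℝ, ℂ)) : fracD 0 T = T := by
  have : symbol 0 = fun _ : ℝ ↦ (1 : ℂ) := by
    funext ξ; simp [symbol]
  simp [fracD, this]

/-- The tempered distribution `T` is (integration against) the function `g`, and `g` is square
integrable on every bounded interval. -/
def IsLocL2Fun (T : 𝓢'(ℝ, ℂ)) (g : ℝ → ℂ) : Prop :=
  (∀ R : ℝ, MemLp g 2 (volume.restrict (Set.Icc (-R) R))) ∧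
    ∀ f : 𝓢(ℝ, ℂ), HasCompactSupport (f : ℝ → ℂ) → T f = ∫ x, f x * g x

theorem IsLocL2Fun.locallyIntegrable {T : 𝓢'(ℝ, ℂ)} {g : ℝ → ℂ} (h : IsLocL2Fun T g) :
    LocallyIntegrable g volume := by
  rw [locallyIntegrable_iff]
  intro k hk
  obtain ⟨R, hR⟩ := hk.isBounded.subset_closedBall (0 : ℝ)
  rw [Real.closedBall_eq_Icc] at hR
  have : IntegrableOn g (Set.Icc (-R) R) := (h.1 R).integrable (by norm_num)
  exact this.mono_set (by simpa using hR)

theorem IsLocL2Fun.integrable_mul {T : 𝓢'(ℝ, ℂ)} {g : ℝ → ℂ} (h : IsLocL2Fun T g)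
    (f : 𝓢(ℝ, ℂ)) (hf : HasCompactSupport (f : ℝ → ℂ)) :
    Integrable (fun x ↦ f x * g x) :=
  h.locallyIntegrable.integrable_smul_left_of_hasCompactSupport f.continuous hf

theorem IsLocL2Fun.zero : IsLocL2Fun 0 0 := by
  refine ⟨fun R ↦ MemLp.zero, fun f _ ↦ ?_⟩
  simp

theorem IsLocL2Fun.add {T S : 𝓢'(ℝ, ℂ)} {g h : ℝ → ℂ} (hT : IsLocL2Fun T g)
    (hS : IsLocL2Fun S h) : IsLocL2Fun (T + S) (g + h) := by
  refine ⟨fun R ↦ (hT.1 R).add (hS.1 R), fun f hf ↦ ?_⟩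
  have : (T + S) f = T f + S f := rfl
  rw [this, hT.2 f hf, hS.2 f hf, ← integral_add (hT.integrable_mul f hf) (hS.integrable_mul f hf)]
  simp [mul_add]

theorem IsLocL2Fun.smul {T : 𝓢'(ℝ, ℂ)} {g : ℝ → ℂ} (c : ℂ) (hT : IsLocL2Fun T g) :
    IsLocL2Fun (c • T) (c • g) := by
  refine ⟨fun R ↦ (hT.1 R).const_smul c, fun f hf ↦ ?_⟩
  have : (c • T) f = c * T f := rfl
  rw [this, hT.2 f hf, ← integral_const_mul]
  congr 1
  funext x
  simp only [Pi.smul_apply, smul_eq_mul]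
  ring

/-- The function that represents a distribution is unique up to a null set. -/
theorem IsLocL2Fun.ae_eq {T : 𝓢'(ℝ, ℂ)} {g h : ℝ → ℂ} (hg : IsLocL2Fun T g)
    (hh : IsLocL2Fun T h) : g =ᵐ[volume] h := by
  refine ae_eq_of_integral_contDiff_smul_eq hg.locallyIntegrable hh.locallyIntegrable
    fun f hf hc ↦ ?_
  have hc' : HasCompactSupport (fun x ↦ (f x : ℂ)) := hc.comp_left (g := Complex.ofReal) (by simp)
  have hf' : ContDiff ℝ ((⊤ : ℕ∞) : WithTop ℕ∞) (fun x ↦ (f x : ℂ)) := Complex.ofRealCLM.contDiff.comp hf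
  have h1 := hg.2 (hc'.toSchwartzMap hf') hc'
  have h2 := hh.2 (hc'.toSchwartzMap hf') hc'
  exact h1.symm.trans h2

/-! ### The space `H^{1/2-}_loc` -/

/-- The tempered distributions `u` with `∫_{[-R,R]} |D ^ s u| ^ 2 < ∞` for all `R` and all
`s < 1/2`. -/
def hLocSubmodule : Submodule ℂ 𝓢'(ℝ, ℂ) where
  carrier := {u | ∀ s : ℝ, s < 1 / 2 → ∃ g : ℝ → ℂ, IsLocL2Fun (fracD s u) g}
  zero_mem' := fun s _ ↦ ⟨0, by rw [map_zero]; exact IsLocL2Fun.zero⟩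
  add_mem' := by
    intro u v hu hv s hs
    obtain ⟨g, hg⟩ := hu s hs
    obtain ⟨h, hh⟩ := hv s hs
    exact ⟨g + h, by rw [map_add]; exact hg.add hh⟩
  smul_mem' := by
    intro c u hu s hs
    obtain ⟨g, hg⟩ := hu s hs
    exact ⟨c • g, by rw [map_smul]; exact hg.smul c⟩

/-- The space `H^{1/2-}_loc`. It is a type of its own, since its topology is not the one induced by
the tempered distributions. -/
def HLoc : Type := hLocSubmodule

namespace HLoc

instance : AddCommGroup HLoc := inferInstanceAs (AddCommGroup hLocSubmodule)

instance : Module ℂ HLoc := inferInstanceAs (Module ℂ hLocSubmodule)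

/-- The underlying tempered distribution. -/
def toDist : HLoc →ₗ[ℂ] 𝓢'(ℝ, ℂ) := hLocSubmodule.subtype

theorem exists_rep (s : Set.Iio (1 / 2 : ℝ)) (u : HLoc) :
    ∃ g : ℝ → ℂ, IsLocL2Fun (fracD s (toDist u)) g :=
  u.2 s s.2

/-- A function that represents `D ^ s u`. -/
def rep (s : Set.Iio (1 / 2 : ℝ)) (u : HLoc) : ℝ → ℂ := (exists_rep s u).choose

theorem rep_spec (s : Set.Iio (1 / 2 : ℝ)) (u : HLoc) :
    IsLocL2Fun (fracD s (toDist u)) (rep s u) :=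
  (exists_rep s u).choose_spec

theorem rep_add (s : Set.Iio (1 / 2 : ℝ)) (u v : HLoc) :
    rep s (u + v) =ᵐ[volume] rep s u + rep s v := by
  refine (rep_spec s (u + v)).ae_eq ?_
  rw [map_add, map_add]
  exact (rep_spec s u).add (rep_spec s v)

theorem rep_smul (s : Set.Iio (1 / 2 : ℝ)) (c : ℂ) (u : HLoc) :
    rep s (c • u) =ᵐ[volume] c • rep s u := by
  refine (rep_spec s (c • u)).ae_eq ?_
  rw [map_smul, map_smul]
  exact (rep_spec s u).smul c

/-- The seminorm `p_{R,s}(u) = (∫_{[-R,R]} |D ^ s u| ^ 2) ^ (1/2)`. -/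
def seminorm (R : ℝ) (s : Set.Iio (1 / 2 : ℝ)) : Seminorm ℂ HLoc :=
  Seminorm.of (fun u ↦ (eLpNorm (rep s u) 2 (volume.restrict (Set.Icc (-R) R))).toReal)
    (by
      intro u v
      rw [eLpNorm_congr_ae (ae_restrict_of_ae (rep_add s u v)),
        ← ENNReal.toReal_add ((rep_spec s u).1 R).2.ne ((rep_spec s v).1 R).2.ne]
      exact ENNReal.toReal_mono
        (ENNReal.add_ne_top.2 ⟨((rep_spec s u).1 R).2.ne, ((rep_spec s v).1 R).2.ne⟩)
        (eLpNorm_add_le ((rep_spec s u).1 R).1 ((rep_spec s v).1 R).1 (by norm_num)))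
    (by
      intro c u
      rw [eLpNorm_congr_ae (ae_restrict_of_ae (rep_smul s c u)), eLpNorm_const_smul,
        ENNReal.toReal_mul]
      simp)

/-- The exponents `1/2 - 1/l`. -/
def expo (l : ℕ+) : Set.Iio (1 / 2 : ℝ) :=
  ⟨1 / 2 - 1 / (l : ℝ), by
    have : (0 : ℝ) < 1 / (l : ℝ) := by positivity
    simp only [Set.mem_Iio]
    linarith⟩

/-- The countable family of the seminorms `p_{R, 1/2 - 1/l}` with positive integers `R`, `l`. -/
def seminormFamily : SeminormFamily ℂ HLoc (ℕ+ × ℕ+) := fun p ↦ seminorm (p.1 : ℝ) (expo p.2)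

/-- The topology induced by these seminorms, that is, the one of the distance
`d(u,v) = ∑_{R,l} 2^{-(R+l)} p_{R,1/2-1/l}(u-v) / (1 + p_{R,1/2-1/l}(u-v))`. -/
instance : TopologicalSpace HLoc := seminormFamily.moduleFilterBasis.topology

theorem withSeminorms : WithSeminorms seminormFamily := ⟨rfl⟩

/-- The topological `σ`-algebra. -/
instance : MeasurableSpace HLoc := borel HLoc

instance : BorelSpace HLoc := ⟨rfl⟩

/-- `u` itself as a function (defined up to a null set). -/
def toFun (u : HLoc) : ℝ → ℂ := rep ⟨0, by norm_num⟩ u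

theorem toFun_spec (u : HLoc) : IsLocL2Fun (toDist u) (toFun u) := by
  have := rep_spec ⟨0, by norm_num⟩ u
  rwa [fracD_zero] at this

end HLoc

/-- The elements of `H^{1/2-}_loc` that belong to `L²(ℝ)`. -/
def squareIntegrable : Set HLoc := {u | MemLp (HLoc.toFun u) 2 volume}

/-! ### The random field `φ` -/

/-- The centred circular complex Gaussian law with `E |z| ^ 2 = v`: the real and the imaginary part
are independent of law `N(0, v / 2)`. -/
def complexGaussian (v : ℝ≥0) : Measure ℂ :=
  ((gaussianReal 0 (v / 2)).prod (gaussianReal 0 (v / 2))).map (fun p : ℝ × ℝ ↦ (⟨p.1, p.2⟩ : ℂ))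

/-- `W` is a complex Brownian motion indexed by the whole real line: two independent complex
Brownian motions, one for each direction of time, with the same initial value. -/
structure IsComplexBrownianMotion {Ω : Type*} [MeasurableSpace Ω] (W : ℝ → Ω → ℂ)
    (P : Measure Ω) : Prop where
  hasLaw_sub : ∀ s t : ℝ, s ≤ t →
    HasLaw (fun ω ↦ W t ω - W s ω) (complexGaussian (t - s).toNNReal) P
  indep : HasIndepIncrements W P
  cont : ∀ᵐ ω ∂P, Continuous (fun t ↦ W t ω)

/-- `φ_{N,R}(ω,x) = ∑_{k=-NR}^{NR-1} (W_{(k+1)/N} - W_{k/N})(ω) (1 + k²/N²)^{-1/2} e^{ikx/N}`. -/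
def approxField {Ω : Type*} (W : ℝ → Ω → ℂ) (N R : ℕ) (ω : Ω) (x : ℝ) : ℂ :=
  ∑ k ∈ Finset.Ico (-((N * R : ℕ) : ℤ)) ((N * R : ℕ) : ℤ),
    (W (((k : ℝ) + 1) / N) ω - W ((k : ℝ) / N) ω) *
      (((√(1 + (k : ℝ) ^ 2 / (N : ℝ) ^ 2))⁻¹ : ℝ) : ℂ) *
      Complex.exp (Complex.I * (((k : ℝ) * x / N : ℝ) : ℂ))

/-- The norm of `√(1+x²) L^∞_x, L²_Ω`:
the essential supremum over `x` of `(1+x²)^{-1/2} ‖f(·,x)‖_{L²(Ω)}`. -/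
def weightedNorm {Ω : Type*} [MeasurableSpace Ω] (P : Measure Ω) (f : Ω → ℝ → ℂ) : ℝ≥0∞ :=
  essSup (fun x : ℝ ↦ ENNReal.ofReal (√(1 + x ^ 2))⁻¹ * eLpNorm (fun ω ↦ f ω x) 2 P) volume

/-- `φ = lim_{R → ∞} φ_R`, where `φ_R = lim_{n → ∞} φ_{2^n,R}`, both limits in
`√(1+x²) L^∞_x, L²_Ω`. -/
def IsLimitField {Ω : Type*} [MeasurableSpace Ω] (W : ℝ → Ω → ℂ) (P : Measure Ω)
    (φ : Ω → ℝ → ℂ) : Prop :=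
  AEStronglyMeasurable (Function.uncurry φ) (P.prod volume) ∧
    ∃ ψ : ℕ → Ω → ℝ → ℂ,
      (∀ R, AEStronglyMeasurable (Function.uncurry (ψ R)) (P.prod volume)) ∧
      (∀ R, Tendsto (fun n : ℕ ↦
        weightedNorm P (fun ω x ↦ approxField W (2 ^ n) R ω x - ψ R ω x)) atTop (𝓝 0)) ∧
      Tendsto (fun R : ℕ ↦ weightedNorm P (fun ω x ↦ ψ R ω x - φ ω x)) atTop (𝓝 0)

/-- `Φ` is the random field `φ` as a random variable with values in `H^{1/2-}_loc`. -/
def IsRandomField {Ω : Type*} [MeasurableSpace Ω] (W : ℝ → Ω → ℂ) (P : Measure Ω)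
    (Φ : Ω → HLoc) : Prop :=
  AEMeasurable Φ P ∧ ∃ φ : Ω → ℝ → ℂ, IsLimitField W P φ ∧
    ∀ᵐ ω ∂P, IsLocL2Fun (HLoc.toDist (Φ ω)) (φ ω)

/-! ### The Gibbs measure -/

/-- The weights `χ` that are allowed in the nonlinearity: `0 ≤ χ(x) ≤ C (√(1+x²))^{-3α}` with some
`α > 1`. -/
def IsAdmissibleWeight (χ : ℝ → ℝ) : Prop :=
  Measurable χ ∧ ∃ C α : ℝ, 1 < α ∧ ∀ x, 0 ≤ χ x ∧ χ x ≤ C * √(1 + x ^ 2) ^ (-(3 * α))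

/-- `∫ χ |Re u|⁴`, possibly infinite. -/
def potential (χ : ℝ → ℝ) (u : HLoc) : ℝ≥0∞ :=
  ∫⁻ x, ENNReal.ofReal (χ x * |(HLoc.toFun u x).re| ^ 4)

open Classical in
/-- `f(u) = exp(-(1/4π) ∫ χ |Re u|⁴)`, which is `0` where the integral is infinite. -/
def gibbsDensity (χ : ℝ → ℝ) (u : HLoc) : ℝ≥0∞ :=
  if potential χ u = ∞ then 0
  else ENNReal.ofReal (Real.exp (-(1 / (4 * Real.pi)) * (potential χ u).toReal))

/-- `dρ = Γ⁻¹ f dμ` with `Γ = ∫ f dμ`. -/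
def gibbsMeasure (χ : ℝ → ℝ) (μ : Measure HLoc) : Measure HLoc :=
  (∫⁻ u, gibbsDensity χ u ∂μ)⁻¹ • μ.withDensity (gibbsDensity χ)

end KleinGordon

end

namespace KleinGordon

open FourierTransform LineDeriv

/-! ### Multiplication by `x` and Fourier multipliers -/

/-! Existence is an `L²(Ω)` computation. `field V s N R` is `D ^ s` of the approximating field, a
Riemann sum for the stochastic integral of `(1 + κ²)^{(s-1)/2} e^{iκx}`, and only the orthogonality
of the increments enters. Halving the mesh costs a second moment of order `(1 + x²) R / N²`, since
the integrand is Lipschitz in `κ` with constant `|s - 1| + |x|` (`lintegral_field_two_mul_sub`).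
Enlarging the frequency range costs a tail of the sum of `(1 + κ²)^{s-1}` (`lintegral_field_sub`),
which is summable exactly when `s < 1/2`. Along the diagonal `N = R = 2 ^ n` both errors are
geometric (`exists_lintegral_field_diagonal`). Divided by `1 + x²` and integrated in `x`, they make
`D ^ s` of the approximations almost surely Cauchy in `(1 + x²) L²` (`ae_exists_tendsto_fieldLp`).

Such convergence for the countably many `s = 1/2 - 1/l` yields a limit in `H^{1/2-}_loc`
(`HLoc.exists_tendsto_of_weighted`). The remaining exponents come from the action of `D ^ t`, `t ≤
0`, on `(1 + x²) L²`, controlled by commuting the multiplier with multiplication by `x` twice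
(`exists_isLocL2Fun_fracD_weighted`). Measurability passes to the limit because the topology is
pseudometrizable.

The failure of square integrability is a small ball argument. At every `x` the real part of an
approximation with nonzero `N` and `R` is Gaussian with variance at least `1/2`, so the field lies
in a ball of radius `r` with probability at most `2r`
(`IsComplexBrownianMotion.measure_approxField_le`). Up to constants this survives both limits for
almost every `x`, whichever version of the field is taken (`IsLimitField.ae_measure_norm_le`). If `∫
|φ|² ≤ C` held on an event `A` of positive probability, then `E(1_A |φ(x)|²)` would be bounded below
uniformly in `x`, although its integral over the line is at most `C` (`ae_lintegral_eq_top`). The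
Gibbs measure has a density with respect to `μ`, so it inherits the null set. -/

theorem symbol_mul (s t : ℝ) : symbol s * symbol t = symbol (s + t) := by
  funext ξ
  simp only [symbol, Pi.mul_apply]
  rw [← Complex.ofReal_mul, ← Real.rpow_add (by positivity), add_div]

theorem fracD_fracD (s t : ℝ) (T : 𝓢'(ℝ, ℂ)) : fracD t (fracD s T) = fracD (s + t) T := by
  rw [fracD, fracD, TemperedDistribution.fourierMultiplierCLM_fourierMultiplierCLM_apply
    (symbol_hasTemperateGrowth s) (symbol_hasTemperateGrowth t), symbol_mul, fracD]

theorem hasTemperateGrowth_ofReal : (fun x : ℝ ↦ (x : ℂ)).HasTemperateGrowth := by fun_prop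

/-- Multiplication by the coordinate. -/
noncomputable def mulX : 𝓢'(ℝ, ℂ) →L[ℂ] 𝓢'(ℝ, ℂ) :=
  TemperedDistribution.smulLeftCLM ℂ (fun x : ℝ ↦ (x : ℂ))

theorem inner_one_eq : (fun x : ℝ ↦ inner ℝ x (1 : ℝ)) = fun x ↦ x := by
  funext x; simp

theorem smulLeft_fourier (v : 𝓢(ℝ, ℂ)) :
    SchwartzMap.smulLeftCLM ℂ (fun x : ℝ ↦ (x : ℂ)) (𝓕 v) =
      (2 * Real.pi * Complex.I)⁻¹ • 𝓕 (∂_{(1 : ℝ)} v) := by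
  rw [SchwartzMap.fourier_lineDerivOp_eq, inner_one_eq, smul_smul, inv_mul_cancel₀ (by
    simp [Real.pi_ne_zero, Complex.I_ne_zero]), one_smul]
  ext x
  rw [SchwartzMap.smulLeftCLM_apply_apply (by fun_prop),
    SchwartzMap.smulLeftCLM_apply_apply (by fun_prop)]
  simp

theorem lineDeriv_fourierInv (v : 𝓢(ℝ, ℂ)) :
    ∂_{(1 : ℝ)} (𝓕⁻ v) = (2 * Real.pi * Complex.I) •
      𝓕⁻ (SchwartzMap.smulLeftCLM ℂ (fun x : ℝ ↦ (x : ℂ)) v) := by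
  rw [SchwartzMap.lineDerivOp_fourierInv_eq, inner_one_eq, FourierTransform.fourierInv_smul]
  congr 2
  ext x
  rw [SchwartzMap.smulLeftCLM_apply_apply (by fun_prop),
    SchwartzMap.smulLeftCLM_apply_apply (by fun_prop)]
  simp

theorem lineDeriv_smulLeft {m m' : ℝ → ℂ} (hm : m.HasTemperateGrowth)
    (hm' : m'.HasTemperateGrowth) (hd : ∀ x, HasDerivAt m (m' x) x) (v : 𝓢(ℝ, ℂ)) :
    ∂_{(1 : ℝ)} (SchwartzMap.smulLeftCLM ℂ m v) =
      SchwartzMap.smulLeftCLM ℂ m' v + SchwartzMap.smulLeftCLM ℂ m (∂_{(1 : ℝ)} v) := by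
  ext x
  have h1 : HasDerivAt (fun y ↦ m y * v y) (m' x * v x + m x * deriv v x) x :=
    (hd x).mul (v.hasDerivAt x)
  have h2 : (SchwartzMap.smulLeftCLM ℂ m v : ℝ → ℂ) = fun y ↦ m y * v y := by
    funext y
    simp [SchwartzMap.smulLeftCLM_apply_apply hm]
  rw [SchwartzMap.lineDerivOp_apply_eq_fderiv, h2, add_apply,
    SchwartzMap.smulLeftCLM_apply_apply hm, SchwartzMap.smulLeftCLM_apply_apply hm',
    SchwartzMap.lineDerivOp_apply_eq_fderiv]
  simp only [fderiv_apply_one_eq_deriv, smul_eq_mul]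
  exact h1.deriv

/-- The commutator of a Fourier multiplier with multiplication by the coordinate. -/
theorem fourierMultiplier_mulX {m m' : ℝ → ℂ} (hm : m.HasTemperateGrowth)
    (hm' : m'.HasTemperateGrowth) (hd : ∀ x, HasDerivAt m (m' x) x) (T : 𝓢'(ℝ, ℂ)) :
    TemperedDistribution.fourierMultiplierCLM ℂ m (mulX T) =
      mulX (TemperedDistribution.fourierMultiplierCLM ℂ m T) +
        (2 * Real.pi * Complex.I)⁻¹ • TemperedDistribution.fourierMultiplierCLM ℂ m' T := by
  ext u
  -- The operators on distributions are transposes, so it suffices to prove the transposed identity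
  -- on Schwartz functions. There multiplication by `x` is a derivative on the Fourier side, and the
  -- commutator term is the product rule.
  have key : SchwartzMap.smulLeftCLM ℂ (fun x : ℝ ↦ (x : ℂ))
      (𝓕 (SchwartzMap.smulLeftCLM ℂ m (𝓕⁻ u))) =
      𝓕 (SchwartzMap.smulLeftCLM ℂ m
        (𝓕⁻ (SchwartzMap.smulLeftCLM ℂ (fun x : ℝ ↦ (x : ℂ)) u))) +
      (2 * Real.pi * Complex.I)⁻¹ • 𝓕 (SchwartzMap.smulLeftCLM ℂ m' (𝓕⁻ u)) := by
    rw [smulLeft_fourier, lineDeriv_smulLeft hm hm' hd, lineDeriv_fourierInv,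
      FourierTransform.fourier_add, map_smul, FourierTransform.fourier_smul, smul_add, smul_smul,
      inv_mul_cancel₀ (by simp [Real.pi_ne_zero, Complex.I_ne_zero]), one_smul, add_comm]
  have h2 := congrArg T key
  rw [map_add, map_smul] at h2
  exact h2

/-! ### Square integrable functions with the weight `1 + x ^ 2` -/

/-- The weight `1 + x ^ 2`. -/
noncomputable def weight (x : ℝ) : ℂ := ((1 + x ^ 2 : ℝ) : ℂ)

theorem weight_hasTemperateGrowth : weight.HasTemperateGrowth := by
  unfold weight; fun_prop

theorem weight_ne_zero (x : ℝ) : weight x ≠ 0 := by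
  unfold weight
  exact_mod_cast (by positivity : (1 + x ^ 2 : ℝ) ≠ 0)

theorem memLp_restrict_of_bound {g h : ℝ → ℂ} (R C : ℝ) (hg : MemLp g 2 volume)
    (hh : Continuous h) (hC : ∀ x ∈ Set.Icc (-R) R, ‖h x‖ ≤ C) :
    MemLp (fun x ↦ h x * g x) 2 (volume.restrict (Set.Icc (-R) R)) := by
  refine MemLp.of_le_mul (c := C) (hg.restrict _)
    (hh.aestronglyMeasurable.mul hg.1.restrict) ?_
  refine (ae_restrict_iff' measurableSet_Icc).2 (ae_of_all _ fun x hx ↦ ?_)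
  rw [norm_mul]
  exact mul_le_mul_of_nonneg_right (hC x hx) (norm_nonneg _)

theorem IsLocL2Fun.smulLeft {h : ℝ → ℂ} (hh : h.HasTemperateGrowth)
    (G : Lp ℂ 2 (volume : Measure ℝ)) :
    IsLocL2Fun (TemperedDistribution.smulLeftCLM ℂ h (G : 𝓢'(ℝ, ℂ))) (fun x ↦ h x * G x) := by
  have hc : Continuous h := hh.1.continuous
  refine ⟨fun R ↦ ?_, fun f _ ↦ ?_⟩
  · obtain ⟨C, hC⟩ := (isCompact_Icc (a := -R) (b := R)).exists_bound_of_continuousOn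
      hc.continuousOn
    exact memLp_restrict_of_bound R C (Lp.memLp G) hc hC
  · rw [TemperedDistribution.smulLeftCLM_apply_apply, Lp.toTemperedDistribution_apply]
    refine integral_congr_ae (ae_of_all _ fun x ↦ ?_)
    simp only [SchwartzMap.smulLeftCLM_apply_apply hh, smul_eq_mul]
    ring

/-- The tempered distribution `(1 + x ^ 2) G` of a square integrable function `G`. -/
noncomputable def weighted : Lp ℂ 2 (volume : Measure ℝ) →L[ℂ] 𝓢'(ℝ, ℂ) :=
  (TemperedDistribution.smulLeftCLM ℂ weight).comp (Lp.toTemperedDistributionCLM ℂ volume 2)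

theorem weighted_isLocL2Fun (G : Lp ℂ 2 (volume : Measure ℝ)) :
    IsLocL2Fun (weighted G) (fun x ↦ weight x * G x) :=
  IsLocL2Fun.smulLeft weight_hasTemperateGrowth G

/-- Writing the weight as `1 + x · x` lets the commutator formula be applied one factor at a time.
-/
theorem weighted_eq (G : Lp ℂ 2 (volume : Measure ℝ)) :
    weighted G = (G : 𝓢'(ℝ, ℂ)) + mulX (mulX (G : 𝓢'(ℝ, ℂ))) := by
  have h1 : weight = (fun _ ↦ (1 : ℂ)) + (fun x : ℝ ↦ (x : ℂ)) * (fun x : ℝ ↦ (x : ℂ)) := by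
    funext x; simp [weight, sq]
  have h2 : weighted G = TemperedDistribution.smulLeftCLM ℂ weight (G : 𝓢'(ℝ, ℂ)) := rfl
  rw [h2, h1, TemperedDistribution.smulLeftCLM_add (by fun_prop) (by fun_prop), mulX,
    TemperedDistribution.smulLeftCLM_smulLeftCLM_apply (by fun_prop) (by fun_prop)]
  simp

/-- This is Plancherel, read through the identification of `L²` with the Sobolev space of order `0`.
-/
theorem exists_lp_fourierMultiplier {m : ℝ → ℂ} (hm : m.HasTemperateGrowth)
    (hb : ∃ C, ∀ x, ‖m x‖ ≤ C) (G : Lp ℂ 2 (volume : Measure ℝ)) :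
    ∃ H : Lp ℂ 2 (volume : Measure ℝ),
      TemperedDistribution.fourierMultiplierCLM ℂ m (G : 𝓢'(ℝ, ℂ)) = (H : 𝓢'(ℝ, ℂ)) :=
  TemperedDistribution.memSobolev_zero_iff.1
    (TemperedDistribution.MemSobolev.fourierMultiplierCLM_of_bounded
      (TemperedDistribution.memSobolev_zero_iff.2 ⟨G, rfl⟩) hm hb)

/-- A multiplier with bounded derivatives up to order two maps `(1 + x ^ 2) L²` into functions that
are locally square integrable. -/
theorem exists_isLocL2Fun_fourierMultiplier {m m' m'' : ℝ → ℂ} (hm : m.HasTemperateGrowth)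
    (hm' : m'.HasTemperateGrowth) (hm'' : m''.HasTemperateGrowth)
    (hd : ∀ x, HasDerivAt m (m' x) x) (hd' : ∀ x, HasDerivAt m' (m'' x) x)
    (hb : ∃ C, ∀ x, ‖m x‖ ≤ C) (hb' : ∃ C, ∀ x, ‖m' x‖ ≤ C) (hb'' : ∃ C, ∀ x, ‖m'' x‖ ≤ C)
    (G : Lp ℂ 2 (volume : Measure ℝ)) :
    ∃ g, IsLocL2Fun (TemperedDistribution.fourierMultiplierCLM ℂ m (weighted G)) g := by
  obtain ⟨H, hH⟩ := exists_lp_fourierMultiplier hm hb G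
  obtain ⟨H', hH'⟩ := exists_lp_fourierMultiplier hm' hb' G
  obtain ⟨H'', hH''⟩ := exists_lp_fourierMultiplier hm'' hb'' G
  set c : ℂ := (2 * Real.pi * Complex.I)⁻¹
  -- Two commutations turn `m(D) (1 + x²)` into `(1 + x²) m(D) + 2c x m'(D) + c² m''(D)`. Each
  -- multiplier now acts directly on `L²`, and only polynomial factors remain outside.
  have e : TemperedDistribution.fourierMultiplierCLM ℂ m (weighted G) =
      weighted H + ((2 * c) • mulX (H' : 𝓢'(ℝ, ℂ)) + (c ^ 2) • (H'' : 𝓢'(ℝ, ℂ))) := by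
    rw [weighted_eq, map_add, fourierMultiplier_mulX hm hm' hd, fourierMultiplier_mulX hm hm' hd,
      fourierMultiplier_mulX hm' hm'' hd', hH, hH', hH'', weighted_eq, map_add, map_smul]
    module
  have h0 : IsLocL2Fun (H'' : 𝓢'(ℝ, ℂ)) (fun x ↦ 1 * H'' x) := by
    have := IsLocL2Fun.smulLeft (h := fun _ ↦ (1 : ℂ)) (by fun_prop) H''
    simpa using this
  rw [e]
  exact ⟨_, (weighted_isLocL2Fun H).add
    (((IsLocL2Fun.smulLeft hasTemperateGrowth_ofReal H').smul _).add (h0.smul _))⟩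

theorem hasDerivAt_symbol (s ξ : ℝ) :
    HasDerivAt (symbol s) (s * (2 * Real.pi) ^ 2 * ξ * symbol (s - 2) ξ) ξ := by
  have hpos : (0 : ℝ) < 1 + (2 * Real.pi * ξ) ^ 2 := by positivity
  have h1 : HasDerivAt (fun ξ : ℝ ↦ 1 + (2 * Real.pi * ξ) ^ 2)
      (2 * (2 * Real.pi * ξ) * (2 * Real.pi)) ξ := by
    have := (((hasDerivAt_id ξ).const_mul (2 * Real.pi)).pow 2).const_add 1
    simpa using this
  have h2 := (h1.rpow_const (p := s / 2) (Or.inl hpos.ne')).ofReal_comp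
  refine h2.congr_deriv ?_
  simp only [symbol]
  rw [show (s - 2) / 2 = s / 2 - 1 by ring]
  push_cast
  ring

theorem norm_symbol_le_one {s : ℝ} (hs : s ≤ 0) (ξ : ℝ) : ‖symbol s ξ‖ ≤ 1 := by
  rw [symbol, Complex.norm_real, Real.norm_of_nonneg (by positivity)]
  refine Real.rpow_le_one_of_one_le_of_nonpos ?_ (by linarith)
  nlinarith [sq_nonneg (2 * Real.pi * ξ)]

/-- The second derivative of the symbol contains `ξ²` times a symbol of order `s - 4`; two orders of
decay suffice to absorb `ξ²`. -/
theorem norm_sq_mul_symbol_le {s : ℝ} (hs : s ≤ -2) (ξ : ℝ) : ‖(ξ : ℂ) ^ 2 * symbol s ξ‖ ≤ 1 := by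
  have h0 : symbol s ξ = symbol (s + 2) ξ * symbol (-2) ξ := by
    have := congrFun (symbol_mul (s + 2) (-2)) ξ
    rw [show s + 2 + -2 = s by ring] at this
    exact this.symm
  have h1 : ‖(ξ : ℂ) ^ 2 * symbol (-2) ξ‖ ≤ 1 := by
    rw [symbol, norm_mul, norm_pow, Complex.norm_real, Complex.norm_real, Real.norm_eq_abs, sq_abs,
      Real.norm_of_nonneg (by positivity), show (-2 : ℝ) / 2 = -1 by norm_num, Real.rpow_neg_one,
      ← div_eq_mul_inv, div_le_one (by positivity)]
    have : (1 : ℝ) ≤ (2 * Real.pi) ^ 2 := by nlinarith [Real.pi_gt_three]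
    nlinarith [sq_nonneg ξ]
  rw [h0, show (ξ : ℂ) ^ 2 * (symbol (s + 2) ξ * symbol (-2) ξ) =
    symbol (s + 2) ξ * ((ξ : ℂ) ^ 2 * symbol (-2) ξ) by ring, norm_mul]
  exact mul_le_one₀ (norm_symbol_le_one (by linarith) ξ) (norm_nonneg _) h1

theorem norm_mul_symbol_le {s : ℝ} (hs : s ≤ -2) (ξ : ℝ) : ‖(ξ : ℂ) * symbol s ξ‖ ≤ 1 := by
  have h1 := norm_sq_mul_symbol_le hs ξ
  have h2 := norm_symbol_le_one (by linarith : s ≤ 0) ξ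
  rw [norm_mul] at *
  rw [norm_pow] at h1
  nlinarith [norm_nonneg (symbol s ξ), norm_nonneg (ξ : ℂ), sq_nonneg (‖(ξ : ℂ)‖ - 1)]

/-- `D ^ s` with `s ≤ 0` maps `(1 + x ^ 2) L²` into functions that are locally square
integrable. -/
theorem exists_isLocL2Fun_fracD_weighted {s : ℝ} (hs : s ≤ 0) (G : Lp ℂ 2 (volume : Measure ℝ)) :
    ∃ g, IsLocL2Fun (fracD s (weighted G)) g := by
  have t2 := symbol_hasTemperateGrowth (s - 2)
  have t4 := symbol_hasTemperateGrowth (s - 2 - 2)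
  refine exists_isLocL2Fun_fourierMultiplier (m := symbol s)
    (m' := fun ξ : ℝ ↦ s * (2 * Real.pi) ^ 2 * ξ * symbol (s - 2) ξ)
    (m'' := fun ξ : ℝ ↦ s * (2 * Real.pi) ^ 2 * symbol (s - 2) ξ +
      s * (2 * Real.pi) ^ 2 * ξ * (((s - 2 : ℝ) : ℂ) * (2 * Real.pi) ^ 2 * ξ * symbol (s - 2 - 2) ξ))
    (symbol_hasTemperateGrowth s) (by fun_prop) (by fun_prop) (hasDerivAt_symbol s) (fun ξ ↦ ?_)
    ⟨1, norm_symbol_le_one hs⟩ ⟨‖(s * (2 * Real.pi) ^ 2 : ℂ)‖, fun ξ ↦ ?_⟩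
    ⟨‖(s * (2 * Real.pi) ^ 2 : ℂ)‖ +
      ‖(s * (2 * Real.pi) ^ 2 * ((s - 2 : ℝ) * (2 * Real.pi) ^ 2) : ℂ)‖,
      fun ξ ↦ ?_⟩ G
  · have h1 : HasDerivAt (fun ξ : ℝ ↦ (s * (2 * Real.pi) ^ 2 * ξ : ℂ))
        (s * (2 * Real.pi) ^ 2) ξ := by
      simpa using (Complex.ofRealCLM.hasDerivAt (x := ξ)).const_mul (s * (2 * Real.pi) ^ 2 : ℂ)
    exact h1.mul (hasDerivAt_symbol (s - 2) ξ)
  · rw [mul_assoc, norm_mul]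
    exact mul_le_of_le_one_right (norm_nonneg _) (norm_mul_symbol_le (by linarith) ξ)
  · refine (norm_add_le _ _).trans (add_le_add ?_ ?_)
    · rw [norm_mul]
      exact mul_le_of_le_one_right (norm_nonneg _) (norm_symbol_le_one (by linarith) ξ)
    · rw [show (s * (2 * Real.pi) ^ 2 * ξ * (((s - 2 : ℝ) : ℂ) * (2 * Real.pi) ^ 2 * ξ *
        symbol (s - 2 - 2) ξ) : ℂ) = (s * (2 * Real.pi) ^ 2 * ((s - 2 : ℝ) * (2 * Real.pi) ^ 2)) *
        ((ξ : ℂ) ^ 2 * symbol (s - 2 - 2) ξ) by ring, norm_mul]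
      exact mul_le_of_le_one_right (norm_nonneg _) (norm_sq_mul_symbol_le (by linarith) ξ)

/-! ### Plane waves -/

/-- The plane wave `e ^ (i κ x)` as a tempered distribution. -/
noncomputable def planeWave (κ : ℝ) : 𝓢'(ℝ, ℂ) :=
  𝓕⁻ (TemperedDistribution.delta (κ / (2 * Real.pi)))

theorem planeWave_apply (κ : ℝ) (f : 𝓢(ℝ, ℂ)) :
    planeWave κ f = ∫ x, f x * Complex.exp (Complex.I * ((κ * x : ℝ) : ℂ)) := by
  rw [planeWave, TemperedDistribution.fourierInv_apply, TemperedDistribution.delta_apply,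
    SchwartzMap.fourierInv_coe, Real.fourierInv_eq']
  refine integral_congr_ae (ae_of_all _ fun x ↦ ?_)
  simp only [RCLike.inner_apply, conj_trivial, smul_eq_mul]
  rw [mul_comm]
  congr 2
  push_cast
  have : (Real.pi : ℂ) ≠ 0 := by exact_mod_cast Real.pi_ne_zero
  field_simp

theorem smulLeft_delta {h : ℝ → ℂ} (hh : h.HasTemperateGrowth) (b : ℝ) :
    TemperedDistribution.smulLeftCLM ℂ h (TemperedDistribution.delta b) =
      h b • TemperedDistribution.delta b := by
  ext f
  have : (h b • TemperedDistribution.delta b : 𝓢'(ℝ, ℂ)) f = h b * f b := rfl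
  rw [this]
  simp [SchwartzMap.smulLeftCLM_apply_apply hh]

/-- On the Fourier side a plane wave is a point mass at `κ / 2π`, and multiplying by the symbol only
evaluates it there. -/
theorem fracD_planeWave (s κ : ℝ) :
    fracD s (planeWave κ) = (((1 + κ ^ 2) ^ (s / 2) : ℝ) : ℂ) • planeWave κ := by
  rw [fracD, TemperedDistribution.fourierMultiplierCLM_apply, planeWave,
    FourierTransform.fourier_fourierInv_eq, smulLeft_delta (symbol_hasTemperateGrowth s),
    FourierTransform.fourierInv_smul, symbol, mul_div_cancel₀ _ (by positivity)]

theorem planeWave_isLocL2Fun (κ : ℝ) :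
    IsLocL2Fun (planeWave κ) (fun x ↦ Complex.exp (Complex.I * ((κ * x : ℝ) : ℂ))) := by
  refine ⟨fun R ↦ ?_, fun f _ ↦ planeWave_apply κ f⟩
  refine MemLp.of_bound (by fun_prop) 1 (ae_of_all _ fun x ↦ ?_)
  rw [mul_comm, Complex.norm_exp_ofReal_mul_I]

theorem planeWave_mem (κ : ℝ) : planeWave κ ∈ hLocSubmodule := fun s _ ↦ by
  rw [fracD_planeWave]
  exact ⟨_, (planeWave_isLocL2Fun κ).smul _⟩

/-- The plane wave as an element of `H^{1/2-}_loc`. -/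
noncomputable def HLoc.wave (κ : ℝ) : HLoc := (⟨planeWave κ, planeWave_mem κ⟩ : hLocSubmodule)

theorem HLoc.toDist_wave (κ : ℝ) : HLoc.toDist (HLoc.wave κ) = planeWave κ := rfl

/-- A distribution that lies in `(1 + x ^ 2) L²` together with `D ^ s` of it for a sequence of
exponents `s` that tends to `1 / 2` belongs to `H^{1/2-}_loc`. -/
theorem mem_hLocSubmodule {T : 𝓢'(ℝ, ℂ)}
    (h : ∀ l : ℕ+, ∃ G, fracD (HLoc.expo l) T = weighted G) : T ∈ hLocSubmodule := by
  intro s hs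
  obtain ⟨n, hn⟩ := exists_nat_one_div_lt (sub_pos.2 hs)
  set l : ℕ+ := ⟨n + 1, n.succ_pos⟩
  obtain ⟨G, hG⟩ := h l
  have hl : (HLoc.expo l : ℝ) = 1 / 2 - 1 / ((n : ℝ) + 1) := by
    simp [HLoc.expo, l]
  have : fracD s T = fracD (s - HLoc.expo l) (weighted G) := by
    rw [← hG, fracD_fracD, add_sub_cancel]
  rw [this]
  exact exists_isLocL2Fun_fracD_weighted (by rw [hl]; linarith) G

/-! ### Topology and measurability of `H^{1/2-}_loc` -/

namespace HLoc

instance : IsTopologicalAddGroup HLoc := seminormFamily.addGroupFilterBasis.isTopologicalAddGroup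

instance : ContinuousSMul ℂ HLoc := seminormFamily.moduleFilterBasis.continuousSMul

/-- Countably many seminorms give a countably generated uniformity. This is what makes almost sure
limits of random variables measurable. -/
instance : TopologicalSpace.PseudoMetrizableSpace HLoc := by
  let _ : UniformSpace HLoc := IsTopologicalAddGroup.rightUniformSpace HLoc
  have : IsUniformAddGroup HLoc := isUniformAddGroup_of_addCommGroup
  have := withSeminorms.firstCountableTopology
  have : (uniformity HLoc).IsCountablyGenerated := IsUniformAddGroup.uniformity_countably_generated
  exact UniformSpace.pseudoMetrizableSpace

theorem seminorm_eq (R : ℝ) (s : Set.Iio (1 / 2 : ℝ)) {u : HLoc} {g : ℝ → ℂ}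
    (hg : IsLocL2Fun (fracD s (toDist u)) g) :
    seminorm R s u = (eLpNorm g 2 (volume.restrict (Set.Icc (-R) R))).toReal := by
  rw [← eLpNorm_congr_ae (ae_restrict_of_ae ((rep_spec s u).ae_eq hg))]
  rfl

theorem continuous_seminorm (R l : ℕ+) : Continuous (seminorm (R : ℝ) (expo l)) :=
  withSeminorms.continuous_seminorm (R, l)

theorem toFun_ae_eq {u : HLoc} {g : ℝ → ℂ} (hg : IsLocL2Fun (toDist u) g) :
    toFun u =ᵐ[volume] g :=
  (toFun_spec u).ae_eq hg

/-- The index `l = 2` corresponds to `s = 1/2 - 1/2 = 0`, so its seminorms are plain `L²` norms on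
intervals. -/
theorem eLpNorm_toFun_restrict (u : HLoc) (R : ℕ+) :
    eLpNorm (toFun u) 2 (volume.restrict (Set.Icc (-(R : ℝ)) R)) =
      ENNReal.ofReal (seminorm (R : ℝ) (expo 2) u) := by
  have h0 : ((expo 2 : Set.Iio (1 / 2 : ℝ)) : ℝ) = 0 := by simp [expo]
  have h : IsLocL2Fun (fracD (expo 2) (toDist u)) (toFun u) := by
    rw [h0, fracD_zero]; exact toFun_spec u
  rw [seminorm_eq _ _ h, ENNReal.ofReal_toReal (h.1 _).2.ne]

theorem iUnion_Icc_pnat : ⋃ R : ℕ+, Set.Icc (-((R : ℕ) : ℝ)) ((R : ℕ) : ℝ) = Set.univ := by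
  refine Set.eq_univ_of_forall fun x ↦ ?_
  obtain ⟨n, hn⟩ := exists_nat_ge |x|
  refine Set.mem_iUnion.2 ⟨⟨n + 1, n.succ_pos⟩, ?_⟩
  rw [Set.mem_Icc, ← abs_le]
  push_cast [PNat.mk_coe]
  linarith

/-- By monotone convergence along the intervals `[-R, R]`. In this form the set is a countable union
of closed sets, hence Borel. -/
theorem mem_squareIntegrable_iff (u : HLoc) :
    u ∈ squareIntegrable ↔ ∃ M : ℕ, ∀ R : ℕ+, seminorm (R : ℝ) (expo 2) u ≤ M := by
  have hm : AEStronglyMeasurable (toFun u) volume :=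
    (toFun_spec u).locallyIntegrable.aestronglyMeasurable
  have hmono : Monotone fun R : ℕ+ ↦ Set.Icc (-((R : ℕ) : ℝ)) ((R : ℕ) : ℝ) := by
    intro R S h
    have : ((R : ℕ) : ℝ) ≤ ((S : ℕ) : ℝ) := by exact_mod_cast h
    exact Set.Icc_subset_Icc (by linarith) this
  constructor
  · intro h
    have h' : MemLp (toFun u) 2 volume := h
    obtain ⟨M, hM⟩ := exists_nat_ge (eLpNorm (toFun u) 2 volume).toReal
    refine ⟨M, fun R ↦ le_trans ?_ hM⟩
    have := eLpNorm_toFun_restrict u R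
    rw [← ENNReal.toReal_ofReal (apply_nonneg (seminorm (R : ℝ) (expo 2)) u), ← this]
    exact ENNReal.toReal_mono h'.2.ne (eLpNorm_restrict_le _ _ _ _)
  · rintro ⟨M, hM⟩
    refine ⟨hm, ?_⟩
    have key : ∫⁻ x, ‖toFun u x‖ₑ ^ 2 ≤ (ENNReal.ofReal M) ^ 2 := by
      rw [← setLIntegral_univ, ← iUnion_Icc_pnat,
        setLIntegral_iUnion_of_directed _ (directed_of_isDirected_le hmono)]
      refine iSup_le fun R ↦ ?_
      have h1 := eLpNorm_toFun_restrict u R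
      have h2 : eLpNorm (toFun u) 2 (volume.restrict (Set.Icc (-(R : ℝ)) R)) ^ 2 =
          ∫⁻ x in Set.Icc (-(R : ℝ)) R, ‖toFun u x‖ₑ ^ 2 := by
        have := eLpNorm_nnreal_pow_eq_lintegral (p := 2) (f := toFun u)
          (μ := volume.restrict (Set.Icc (-(R : ℝ)) R)) (by norm_num)
        simpa using this
      rw [← h2, h1]
      gcongr
      exact hM R
    have h3 := eLpNorm_nnreal_pow_eq_lintegral (p := 2) (f := toFun u) (μ := volume) (by norm_num)
    have h4 : eLpNorm (toFun u) 2 volume ^ 2 < ∞ := by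
      have : eLpNorm (toFun u) 2 volume ^ 2 = ∫⁻ x, ‖toFun u x‖ₑ ^ 2 := by simpa using h3
      rw [this]
      exact key.trans_lt (by simp)
    exact (ENNReal.pow_lt_top_iff.1 h4).resolve_right (by norm_num)

theorem measurableSet_squareIntegrable : MeasurableSet squareIntegrable := by
  have : squareIntegrable = ⋃ M : ℕ, ⋂ R : ℕ+, {u | seminorm (R : ℝ) (expo 2) u ≤ M} := by
    ext u; simp [mem_squareIntegrable_iff]
  rw [this]
  exact MeasurableSet.iUnion fun M ↦ MeasurableSet.iInter fun R ↦
    (isClosed_le (continuous_seminorm R 2) continuous_const).measurableSet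

/-- Finite linear combinations of fixed vectors with random coefficients are random variables. -/
theorem measurable_sum_smul {Ω ι : Type*} [MeasurableSpace Ω] (I : Finset ι) (e : ι → HLoc)
    {c : ι → Ω → ℂ} (hc : ∀ i, Measurable (c i)) :
    Measurable fun ω ↦ ∑ i ∈ I, c i ω • e i := by
  have h1 : Measurable fun ω (i : I) ↦ c i ω := measurable_pi_lambda _ fun i ↦ hc i
  -- Factoring through the finite-dimensional space of coefficients avoids measurability of addition
  -- in `HLoc`, which would call for second countability.
  have h2 : Continuous fun z : I → ℂ ↦ ∑ i : I, z i • e i := by fun_prop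
  have h3 := h2.measurable.comp h1
  convert h3 using 1
  funext ω
  exact (Finset.sum_coe_sort I fun i ↦ c i ω • e i).symm

theorem tendsto_of_seminorm {u : ℕ → HLoc} {v : HLoc}
    (h : ∀ R l : ℕ+, Tendsto (fun n ↦ seminorm (R : ℝ) (expo l) (u n - v)) atTop (𝓝 0)) :
    Tendsto u atTop (𝓝 v) := by
  rw [withSeminorms.tendsto_nhds]
  intro i ε hε
  exact (h i.1 i.2).eventually (gt_mem_nhds hε)

end HLoc

/-! ### Processes with orthogonal increments -/

/-- A measurable process with centred orthogonal increments of variance `t - s`. -/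
structure HasOrthogonalIncrements {Ω : Type*} [MeasurableSpace Ω] (V : ℝ → Ω → ℂ)
    (P : Measure Ω) : Prop where
  measurable : ∀ t, Measurable (V t)
  lintegral_sq : ∀ s t, s ≤ t → ∫⁻ ω, ‖V t ω - V s ω‖ₑ ^ 2 ∂P = ENNReal.ofReal (t - s)
  orthogonal : ∀ s t u v, s ≤ t → t ≤ u → u ≤ v →
    ∫ ω, (V v ω - V u ω) * (starRingEnd ℂ) (V t ω - V s ω) ∂P = 0

theorem eLpNorm_two_sq {α E : Type*} [MeasurableSpace α] [NormedAddCommGroup E] (μ : Measure α)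
    (f : α → E) : eLpNorm f 2 μ ^ 2 = ∫⁻ x, ‖f x‖ₑ ^ 2 ∂μ := by
  simpa using eLpNorm_nnreal_pow_eq_lintegral (p := 2) (f := f) (μ := μ) (by norm_num)

theorem norm_sum_smul_sq {ι E : Type*} [NormedAddCommGroup E] [InnerProductSpace ℂ E]
    (I : Finset ι) (c : ι → ℂ) (x : ι → E) {v : ℝ} (hv : ∀ i, ‖x i‖ ^ 2 = v)
    (ho : ∀ i j, i ≠ j → inner ℂ (x i) (x j) = 0) :
    ‖∑ i ∈ I, c i • x i‖ ^ 2 = ∑ i ∈ I, ‖c i‖ ^ 2 * v := by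
  classical
  induction I using Finset.induction_on with
  | empty => simp
  | insert a I ha ih =>
    rw [Finset.sum_insert ha, Finset.sum_insert ha, ← ih, ← hv a, ← mul_pow, ← norm_smul]
    have h0 : inner ℂ (c a • x a) (∑ i ∈ I, c i • x i) = 0 := by
      rw [inner_sum]
      refine Finset.sum_eq_zero fun i hi ↦ ?_
      rw [inner_smul_left, inner_smul_right, ho a i (fun h ↦ ha (h ▸ hi))]
      simp
    have := norm_add_sq_eq_norm_sq_add_norm_sq_of_inner_eq_zero (𝕜 := ℂ) _ _ h0
    simpa [sq] using this

/-- Pythagoras in `L²(Ω)`, after passing to classes of functions. -/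
theorem lintegral_sum_mul_sq {Ω ι : Type*} [MeasurableSpace Ω] {P : Measure Ω} {ξ : ι → Ω → ℂ}
    (hξ : ∀ i, AEStronglyMeasurable (ξ i) P) {v : ℝ} (hv0 : 0 ≤ v)
    (hv : ∀ i, ∫⁻ ω, ‖ξ i ω‖ₑ ^ 2 ∂P = ENNReal.ofReal v)
    (ho : ∀ i j, i ≠ j → ∫ ω, ξ j ω * (starRingEnd ℂ) (ξ i ω) ∂P = 0) (I : Finset ι) (c : ι → ℂ) :
    ∫⁻ ω, ‖∑ i ∈ I, ξ i ω * c i‖ₑ ^ 2 ∂P = ENNReal.ofReal (∑ i ∈ I, ‖c i‖ ^ 2 * v) := by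
  have hm : ∀ i, MemLp (ξ i) 2 P := fun i ↦ ⟨hξ i, by
    have : eLpNorm (ξ i) 2 P ^ 2 < ∞ := by rw [eLpNorm_two_sq, hv]; simp
    exact (ENNReal.pow_lt_top_iff.1 this).resolve_right (by norm_num)⟩
  have hn : ∀ f : Lp ℂ 2 P, ENNReal.ofReal (‖f‖ ^ 2) = ∫⁻ ω, ‖f ω‖ₑ ^ 2 ∂P := fun f ↦ by
    rw [← eLpNorm_two_sq, Lp.norm_def, ENNReal.ofReal_pow ENNReal.toReal_nonneg,
      ENNReal.ofReal_toReal (Lp.eLpNorm_ne_top f)]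
  set x : ι → Lp ℂ 2 P := fun i ↦ (hm i).toLp
  have h1 : ∀ i, ‖x i‖ ^ 2 = v := fun i ↦ by
    have : ENNReal.ofReal (‖x i‖ ^ 2) = ENNReal.ofReal v := by
      rw [hn, ← hv i]
      refine lintegral_congr_ae ?_
      filter_upwards [(hm i).coeFn_toLp] with ω hω
      rw [hω]
    exact (ENNReal.ofReal_eq_ofReal_iff (by positivity) hv0).1 this
  have h2 : ∀ i j, i ≠ j → inner ℂ (x i) (x j) = 0 := fun i j hij ↦ by
    rw [L2.inner_def, ← ho i j hij]
    refine integral_congr_ae ?_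
    filter_upwards [(hm i).coeFn_toLp, (hm j).coeFn_toLp] with ω h h'
    simp only [x, RCLike.inner_apply]
    rw [h, h']
  rw [← norm_sum_smul_sq I c x h1 h2, hn]
  refine lintegral_congr_ae ?_
  have h3 : ∀ᵐ ω ∂P, ∀ i ∈ I, (c i • x i : Lp ℂ 2 P) ω = ξ i ω * c i :=
    (ae_ball_iff I.countable_toSet).2 fun i _ ↦ by
      filter_upwards [Lp.coeFn_smul (c i) (x i), (hm i).coeFn_toLp] with ω h h'
      rw [h, Pi.smul_apply, h', smul_eq_mul, mul_comm]
  filter_upwards [h3, Lp.coeFn_finsetSum I fun i ↦ c i • x i] with ω h h'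
  rw [h', Finset.sum_apply, Finset.sum_congr rfl h]

section Field

variable {Ω : Type*} [MeasurableSpace Ω] {P : Measure Ω} {V : ℝ → Ω → ℂ}

/-- The discrete Itô isometry on a grid of mesh `1 / N`. -/
theorem HasOrthogonalIncrements.lintegral_sum (hV : HasOrthogonalIncrements V P) {N : ℕ}
    (I : Finset ℤ) (c : ℤ → ℂ) :
    ∫⁻ ω, ‖∑ k ∈ I, (V (((k : ℝ) + 1) / N) ω - V ((k : ℝ) / N) ω) * c k‖ₑ ^ 2 ∂P =
      ENNReal.ofReal (∑ k ∈ I, ‖c k‖ ^ 2 * (1 / N)) := by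
  have hle : ∀ k : ℤ, (k : ℝ) / N ≤ ((k : ℝ) + 1) / N := fun k ↦ by gcongr; linarith
  have horth : ∀ i j : ℤ, i < j → ∫ ω, (V (((j : ℝ) + 1) / N) ω - V ((j : ℝ) / N) ω) *
      (starRingEnd ℂ) (V (((i : ℝ) + 1) / N) ω - V ((i : ℝ) / N) ω) ∂P = 0 := fun i j hij ↦ by
    refine hV.orthogonal _ _ _ _ (hle i) ?_ (hle j)
    have : (i : ℝ) + 1 ≤ j := by exact_mod_cast hij
    gcongr
  refine lintegral_sum_mul_sq (ξ := fun (k : ℤ) ω ↦ V (((k : ℝ) + 1) / N) ω - V ((k : ℝ) / N) ω)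
    (fun k ↦ ((hV.measurable _).sub (hV.measurable _)).aestronglyMeasurable) (by positivity)
    (fun k ↦ ?_) (fun i j hij ↦ ?_) I c
  · rw [hV.lintegral_sq _ _ (hle k)]
    congr 1
    ring
  · rcases lt_or_gt_of_ne hij with h | h
    · exact horth i j h
    · rw [← map_zero (starRingEnd ℂ), ← horth j i h, ← integral_conj]
      refine integral_congr_ae (ae_of_all _ fun ω ↦ ?_)
      simp [mul_comm]

/-! ### The approximating fields -/

/-- `(1 + κ²)^{(s-1)/2} e^{iκx}`. -/
noncomputable def profile (s x κ : ℝ) : ℂ :=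
  (((1 + κ ^ 2) ^ ((s - 1) / 2) : ℝ) : ℂ) * Complex.exp (Complex.I * ((κ * x : ℝ) : ℂ))

/-- The approximation of `D ^ s φ`. -/
noncomputable def field (V : ℝ → Ω → ℂ) (s : ℝ) (N R : ℕ) (ω : Ω) (x : ℝ) : ℂ :=
  ∑ k ∈ Finset.Ico (-((N * R : ℕ) : ℤ)) ((N * R : ℕ) : ℤ),
    (V (((k : ℝ) + 1) / N) ω - V ((k : ℝ) / N) ω) * profile s x ((k : ℝ) / N)

theorem approxField_eq_field {Ω : Type*} (V : ℝ → Ω → ℂ) (N R : ℕ) (ω : Ω) (x : ℝ) :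
    approxField V N R ω x = field V 0 N R ω x := by
  refine Finset.sum_congr rfl fun k _ ↦ ?_
  rw [profile, mul_assoc, div_pow, div_mul_eq_mul_div, Real.sqrt_eq_rpow,
    ← Real.rpow_neg (by positivity)]
  norm_num

theorem norm_profile_sq (s x κ : ℝ) : ‖profile s x κ‖ ^ 2 = (1 + κ ^ 2) ^ (s - 1) := by
  rw [profile, norm_mul, mul_comm Complex.I, Complex.norm_exp_ofReal_mul_I, mul_one,
    Complex.norm_real, Real.norm_of_nonneg (by positivity), ← Real.rpow_natCast,
    ← Real.rpow_mul (by positivity)]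
  norm_num

/-- Mean value inequality in `κ`: the derivative of the amplitude is at most `|s - 1|`, and that of
the phase contributes `|x|`. This is the source of the growth `1 + x²` in all later estimates. -/
theorem norm_profile_sub_le {s : ℝ} (hs : s ≤ 1) (x κ κ' : ℝ) :
    ‖profile s x κ - profile s x κ'‖ ≤ (|s - 1| + |x|) * |κ - κ'| := by
  have hd : ∀ κ : ℝ, HasDerivAt (profile s x)
      ((((2 * κ) * ((s - 1) / 2) * (1 + κ ^ 2) ^ ((s - 1) / 2 - 1) : ℝ) : ℂ) *
        Complex.exp (Complex.I * ((κ * x : ℝ) : ℂ)) +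
        (((1 + κ ^ 2) ^ ((s - 1) / 2) : ℝ) : ℂ) *
        (Complex.exp (Complex.I * ((κ * x : ℝ) : ℂ)) * (Complex.I * (x : ℂ)))) κ := fun κ ↦ by
    have h1 : HasDerivAt (fun κ : ℝ ↦ 1 + κ ^ 2) (2 * κ) κ := by
      simpa using ((hasDerivAt_id κ).pow 2).const_add 1
    have h2 := (h1.rpow_const (p := (s - 1) / 2) (Or.inl (by positivity))).ofReal_comp
    have h3 : HasDerivAt (fun κ : ℝ ↦ Complex.I * ((κ * x : ℝ) : ℂ)) (Complex.I * (x : ℂ)) κ := by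
      have := (((hasDerivAt_id κ).mul_const x).ofReal_comp).const_mul Complex.I
      simpa using this
    exact h2.mul h3.cexp
  have hb : ∀ κ : ℝ, ‖deriv (profile s x) κ‖ ≤ |s - 1| + |x| := fun κ ↦ by
    have hpos : (0 : ℝ) < 1 + κ ^ 2 := by positivity
    have hone : (1 : ℝ) ≤ 1 + κ ^ 2 := by nlinarith [sq_nonneg κ]
    have h1 : (1 + κ ^ 2) ^ ((s - 1) / 2) ≤ 1 :=
      Real.rpow_le_one_of_one_le_of_nonpos hone (by linarith)
    rw [(hd κ).deriv]
    refine (norm_add_le _ _).trans (add_le_add ?_ ?_)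
    · rw [norm_mul, mul_comm Complex.I, Complex.norm_exp_ofReal_mul_I, mul_one, Complex.norm_real,
        Real.rpow_sub_one hpos.ne', Real.norm_eq_abs,
        show 2 * κ * ((s - 1) / 2) * ((1 + κ ^ 2) ^ ((s - 1) / 2) / (1 + κ ^ 2)) =
          (s - 1) * ((κ / (1 + κ ^ 2)) * (1 + κ ^ 2) ^ ((s - 1) / 2)) by field_simp, abs_mul,
        abs_mul]
      refine mul_le_of_le_one_right (abs_nonneg _) (mul_le_one₀ ?_ (abs_nonneg _) ?_)
      · rw [abs_div, abs_of_pos hpos, div_le_one hpos]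
        nlinarith [sq_nonneg (|κ| - 1), sq_abs κ, abs_nonneg κ]
      · rwa [abs_of_nonneg (by positivity)]
    · rw [norm_mul, norm_mul, mul_comm Complex.I ((κ * x : ℝ) : ℂ), Complex.norm_exp_ofReal_mul_I,
        one_mul, norm_mul, Complex.norm_I, one_mul, Complex.norm_real, Complex.norm_real,
        Real.norm_of_nonneg (by positivity), Real.norm_eq_abs]
      exact mul_le_of_le_one_left (abs_nonneg _) h1
  have := convex_univ.norm_image_sub_le_of_norm_deriv_le (f := profile s x)
    (fun y _ ↦ (hd y).differentiableAt) (fun y _ ↦ hb y) (Set.mem_univ κ') (Set.mem_univ κ)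
  simpa [Real.norm_eq_abs] using this

/-- The half-open range is not symmetric about `0`: the cell `j` is paired with `-j - 1`, its mirror
image as an interval. -/
theorem sum_Ico_neg {M : Type*} [AddCommMonoid M] (F : ℤ → M) (n : ℕ) :
    ∑ k ∈ Finset.Ico (-(n : ℤ)) n, F k = ∑ j ∈ Finset.range n, (F j + F (-(j : ℤ) - 1)) := by
  induction n with
  | zero => simp
  | succ n ih =>
    have : Finset.Ico (-((n + 1 : ℕ) : ℤ)) ((n + 1 : ℕ) : ℤ) =
        insert (n : ℤ) (insert (-(n : ℤ) - 1) (Finset.Ico (-(n : ℤ)) n)) := by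
      ext k; simp only [Finset.mem_Ico, Finset.mem_insert]; omega
    rw [this, Finset.sum_insert (by simp only [Finset.mem_Ico, Finset.mem_insert]; omega),
      Finset.sum_insert (by simp only [Finset.mem_Ico]; omega), ih, Finset.sum_range_succ,
      ← add_assoc, add_comm]

theorem sum_range_two_mul {M : Type*} [AddCommMonoid M] (F : ℕ → M) (n : ℕ) :
    ∑ j ∈ Finset.range (2 * n), F j = ∑ j ∈ Finset.range n, (F (2 * j) + F (2 * j + 1)) := by
  induction n with
  | zero => simp
  | succ n ih =>
    rw [show 2 * (n + 1) = 2 * n + 1 + 1 by ring, Finset.sum_range_succ, Finset.sum_range_succ, ih,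
      Finset.sum_range_succ, add_assoc]

theorem sum_Ico_two_mul {M : Type*} [AddCommMonoid M] (F : ℤ → M) (n : ℕ) :
    ∑ k ∈ Finset.Ico (-((2 * n : ℕ) : ℤ)) ((2 * n : ℕ) : ℤ), F k =
      ∑ k ∈ Finset.Ico (-(n : ℤ)) n, (F (2 * k) + F (2 * k + 1)) := by
  rw [sum_Ico_neg, sum_Ico_neg, sum_range_two_mul]
  refine Finset.sum_congr rfl fun j _ ↦ ?_
  rw [show -((2 * j : ℕ) : ℤ) - 1 = 2 * (-(j : ℤ) - 1) + 1 by push_cast; ring,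
    show -((2 * j + 1 : ℕ) : ℤ) - 1 = 2 * (-(j : ℤ) - 1) by push_cast; ring]
  push_cast
  abel

/-- Halving the mesh. -/
theorem lintegral_field_two_mul_sub (hV : HasOrthogonalIncrements V P) {s : ℝ} (hs : s ≤ 1)
    {N : ℕ} (hN : N ≠ 0) (R : ℕ) (x : ℝ) :
    ∫⁻ ω, ‖field V s (2 * N) R ω x - field V s N R ω x‖ₑ ^ 2 ∂P ≤
      ENNReal.ofReal (((s - 1) ^ 2 + 1) * (1 + x ^ 2) * R / N ^ 2) := by
  have hN' : (N : ℝ) ≠ 0 := by exact_mod_cast hN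
  -- On the fine grid, the coarse sum has the same increments but takes the profile at the left end
  -- of the coarse cell. Its index is the floor `j / 2`, also for negative `j`.
  set c : ℤ → ℂ := fun j ↦ profile s x ((j : ℝ) / (2 * N : ℕ)) -
    profile s x (((j / 2 : ℤ) : ℝ) / N) with hc
  have h1 : ∀ ω, field V s (2 * N) R ω x - field V s N R ω x =
      ∑ k ∈ Finset.Ico (-((2 * (N * R) : ℕ) : ℤ)) ((2 * (N * R) : ℕ) : ℤ),
        (V (((k : ℝ) + 1) / (2 * N : ℕ)) ω - V ((k : ℝ) / (2 * N : ℕ)) ω) * c k := fun ω ↦ by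
    rw [sum_Ico_two_mul, field, mul_assoc 2 N R, sum_Ico_two_mul, field, ← Finset.sum_sub_distrib]
    refine Finset.sum_congr rfl fun k _ ↦ ?_
    have e1 : (2 * k : ℤ) / 2 = k := by omega
    have e2 : (2 * k + 1 : ℤ) / 2 = k := by omega
    simp only [hc, e1, e2]
    push_cast
    rw [show (2 * (k : ℝ) + 1 + 1) / (2 * N) = ((k : ℝ) + 1) / N by field_simp; ring,
      show 2 * (k : ℝ) / (2 * N) = (k : ℝ) / N by field_simp]
    ring
  have h2 : ∀ j : ℤ, ‖c j‖ ^ 2 ≤ ((s - 1) ^ 2 + 1) * (1 + x ^ 2) / (2 * N ^ 2) := fun j ↦ by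
    have h3 : |(j : ℝ) / (2 * N : ℕ) - ((j / 2 : ℤ) : ℝ) / N| ≤ 1 / (2 * N) := by
      have h4 : (j : ℝ) / (2 * N : ℕ) - ((j / 2 : ℤ) : ℝ) / N =
          ((j % 2 : ℤ) : ℝ) / (2 * N) := by
        have : (j : ℝ) = 2 * ((j / 2 : ℤ) : ℝ) + ((j % 2 : ℤ) : ℝ) := by
          exact_mod_cast (Int.mul_ediv_add_emod j 2).symm
        push_cast
        field_simp
        linarith
      have h5 : |((j % 2 : ℤ) : ℝ)| ≤ 1 := by
        rcases Int.emod_two_eq_zero_or_one j with h | h <;> simp [h]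
      rw [h4, abs_div, abs_of_nonneg (by positivity : (0 : ℝ) ≤ 2 * N)]
      gcongr
    have h6 := (norm_profile_sub_le hs x ((j : ℝ) / (2 * N : ℕ)) (((j / 2 : ℤ) : ℝ) / N)).trans
      (mul_le_mul_of_nonneg_left h3 (by positivity))
    calc ‖c j‖ ^ 2 ≤ ((|s - 1| + |x|) * (1 / (2 * N))) ^ 2 := by gcongr
      _ = (|s - 1| + |x|) ^ 2 / 2 / (2 * N ^ 2) := by field_simp
      _ ≤ _ := by
        gcongr
        have a1 := sq_abs (s - 1)
        have a2 := sq_abs x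
        have a3 : (|s - 1| + |x|) ^ 2 ≤ 2 * (s - 1) ^ 2 + 2 * x ^ 2 := by
          nlinarith [sq_nonneg (|s - 1| - |x|)]
        nlinarith [mul_nonneg (sq_nonneg (s - 1)) (sq_nonneg x)]
  simp_rw [h1]
  rw [hV.lintegral_sum]
  refine ENNReal.ofReal_le_ofReal ?_
  calc _ ≤ ∑ k ∈ Finset.Ico (-((2 * (N * R) : ℕ) : ℤ)) ((2 * (N * R) : ℕ) : ℤ),
        ((s - 1) ^ 2 + 1) * (1 + x ^ 2) / (2 * N ^ 2) * (1 / (2 * N : ℕ)) :=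
        Finset.sum_le_sum fun k _ ↦ by gcongr; exact h2 k
    _ = _ := by
      rw [Finset.sum_const, Int.card_Ico, nsmul_eq_mul,
        show (((2 * (N * R) : ℕ) : ℤ) - -((2 * (N * R) : ℕ) : ℤ)).toNat = 4 * (N * R) by omega]
      push_cast
      field_simp
      ring

/-- Enlarging the range of frequencies. -/
theorem lintegral_field_sub (hV : HasOrthogonalIncrements V P) (s : ℝ) (N : ℕ) {R R' : ℕ}
    (hR : R ≤ R') (x : ℝ) :
    ∫⁻ ω, ‖field V s N R' ω x - field V s N R ω x‖ₑ ^ 2 ∂P =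
      ENNReal.ofReal (∑ j ∈ Finset.Ico (N * R) (N * R'),
        ((1 + ((j : ℝ) / N) ^ 2) ^ (s - 1) + (1 + (((j : ℝ) + 1) / N) ^ 2) ^ (s - 1)) *
          (1 / N)) := by
  have hle : N * R ≤ N * R' := Nat.mul_le_mul_left N hR
  have hsub : Finset.Ico (-((N * R : ℕ) : ℤ)) ((N * R : ℕ) : ℤ) ⊆
      Finset.Ico (-((N * R' : ℕ) : ℤ)) ((N * R' : ℕ) : ℤ) := by
    apply Finset.Ico_subset_Ico <;> omega
  have h1 : ∀ ω, field V s N R' ω x - field V s N R ω x =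
      ∑ k ∈ Finset.Ico (-((N * R' : ℕ) : ℤ)) ((N * R' : ℕ) : ℤ) \
        Finset.Ico (-((N * R : ℕ) : ℤ)) ((N * R : ℕ) : ℤ),
        (V (((k : ℝ) + 1) / N) ω - V ((k : ℝ) / N) ω) * profile s x ((k : ℝ) / N) := fun ω ↦ by
    rw [field, field, Finset.sum_sdiff_eq_sub hsub]
  simp_rw [h1]
  rw [hV.lintegral_sum, Finset.sum_sdiff_eq_sub hsub, sum_Ico_neg, sum_Ico_neg,
    Finset.sum_Ico_eq_sub _ hle]
  congr 2 <;>
  · refine Finset.sum_congr rfl fun j _ ↦ ?_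
    rw [norm_profile_sq, norm_profile_sq, add_mul]
    push_cast
    rw [show (-(j : ℝ) - 1) / N = -(((j : ℝ) + 1) / N) by ring, neg_sq]

end Field

/-! ### Sequences with geometrically decreasing increments -/

section Geometric

variable {Ω E : Type*} [MeasurableSpace Ω] {P : Measure Ω} [NormedAddCommGroup E]

theorem lintegral_le_of_sq [IsProbabilityMeasure P] {f : Ω → ℝ≥0∞} (hf : AEMeasurable f P) {a : ℝ}
    (ha : 0 ≤ a) (h : ∫⁻ ω, f ω ^ 2 ∂P ≤ ENNReal.ofReal a) :
    ∫⁻ ω, f ω ∂P ≤ ENNReal.ofReal (√a) := by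
  have h1 := ENNReal.lintegral_mul_le_Lp_mul_Lq P Real.HolderConjugate.two_two hf
    (aemeasurable_const (b := (1 : ℝ≥0∞)))
  simp only [Pi.mul_apply, mul_one, lintegral_const, measure_univ, ENNReal.rpow_two] at h1
  refine h1.trans ?_
  rw [Real.sqrt_eq_rpow, ← ENNReal.ofReal_rpow_of_nonneg ha (by norm_num)]
  simpa using ENNReal.rpow_le_rpow h (by norm_num : (0 : ℝ) ≤ 1 / 2)

theorem sqrt_pow_eq {q : ℝ} (hq : 0 ≤ q) (n : ℕ) : √(q ^ n) = √q ^ n := by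
  rw [Real.sqrt_eq_iff_mul_self_eq (by positivity) (by positivity), ← mul_pow,
    Real.mul_self_sqrt hq]

theorem tsum_ofReal_geometric_ne_top {C q : ℝ} (hC : 0 ≤ C) (hq0 : 0 ≤ q) (hq1 : q < 1) :
    ∑' n : ℕ, ENNReal.ofReal (√(C * q ^ n)) ≠ ∞ := by
  have h1 : ∀ n : ℕ, √(C * q ^ n) = √C * √q ^ n := fun n ↦ by
    rw [Real.sqrt_mul hC, sqrt_pow_eq hq0]
  have hs : Summable fun n : ℕ ↦ √(C * q ^ n) := by
    simp_rw [h1]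
    exact (summable_geometric_of_lt_one (Real.sqrt_nonneg q)
      (by rw [Real.sqrt_lt' one_pos]; simpa using hq1)).mul_left _
  rw [← ENNReal.ofReal_tsum_of_nonneg (fun n ↦ Real.sqrt_nonneg _) hs]
  exact ENNReal.ofReal_ne_top

/-- Cauchy–Schwarz bounds the first moments by a geometric sequence, so the sum has finite
expectation. -/
theorem ae_tsum_ne_top [IsProbabilityMeasure P] {f : ℕ → Ω → ℝ≥0∞} (hf : ∀ n, AEMeasurable (f n) P)
    {C q : ℝ} (hC : 0 ≤ C) (hq0 : 0 ≤ q) (hq1 : q < 1)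
    (h : ∀ n, ∫⁻ ω, f n ω ^ 2 ∂P ≤ ENNReal.ofReal (C * q ^ n)) :
    ∀ᵐ ω ∂P, ∑' n, f n ω ≠ ∞ := by
  have h1 : ∫⁻ ω, ∑' n, f n ω ∂P ≠ ∞ := by
    rw [lintegral_tsum hf]
    exact ne_top_of_le_ne_top (tsum_ofReal_geometric_ne_top hC hq0 hq1)
      (ENNReal.tsum_le_tsum fun n ↦ lintegral_le_of_sq (hf n) (by positivity) (h n))
  filter_upwards [ae_lt_top' (AEMeasurable.tsum hf) h1] with ω hω using hω.ne

theorem exists_tendsto_of_tsum_enorm_ne_top [CompleteSpace E] {f : ℕ → E}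
    (h : ∑' n, ‖f (n + 1) - f n‖ₑ ≠ ∞) : ∃ l, Tendsto f atTop (𝓝 l) := by
  refine cauchySeq_tendsto_of_complete (cauchySeq_of_edist_le_of_tsum_ne_top _ (fun n ↦ ?_) h)
  rw [edist_comm, edist_eq_enorm_sub]

theorem eLpNorm_two_le {f : Ω → E} {a : ℝ} (ha : 0 ≤ a)
    (h : ∫⁻ ω, ‖f ω‖ₑ ^ 2 ∂P ≤ ENNReal.ofReal a) : eLpNorm f 2 P ≤ ENNReal.ofReal (√a) := by
  have h1 : eLpNorm f 2 P ^ 2 ≤ ENNReal.ofReal (√a) ^ 2 := by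
    rw [eLpNorm_two_sq, ← ENNReal.ofReal_pow (Real.sqrt_nonneg a), Real.sq_sqrt ha]
    exact h
  exact (ENNReal.pow_le_pow_left_iff (by norm_num)).1 h1

/-- Telescoping bounds the distance from `f n` to `f (n + m)` uniformly in `m`, and Fatou passes to
the limit. The bound depends on the increments only. -/
theorem eLpNorm_sub_le_geometric {f : ℕ → Ω → E} (hf : ∀ n, AEStronglyMeasurable (f n) P)
    {C q : ℝ} (hC : 0 ≤ C) (hq0 : 0 ≤ q) (hq1 : q < 1)
    (h : ∀ n, ∫⁻ ω, ‖f (n + 1) ω - f n ω‖ₑ ^ 2 ∂P ≤ ENNReal.ofReal (C * q ^ n)) {g : Ω → E}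
    (hg : ∀ᵐ ω ∂P, Tendsto (fun n ↦ f n ω) atTop (𝓝 (g ω))) (n : ℕ) :
    eLpNorm (fun ω ↦ f n ω - g ω) 2 P ≤ ENNReal.ofReal (√C * (√q ^ n / (1 - √q))) := by
  have hr1 : √q < 1 := by rw [Real.sqrt_lt' one_pos]; simpa using hq1
  have hr0 := Real.sqrt_nonneg q
  have hstep : ∀ k, eLpNorm (fun ω ↦ f k ω - f (k + 1) ω) 2 P ≤ ENNReal.ofReal (√C * √q ^ k) :=
    fun k ↦ by
    have := eLpNorm_two_le (by positivity) (h k)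
    rw [Real.sqrt_mul hC, sqrt_pow_eq hq0] at this
    rwa [← eLpNorm_neg, show -(fun ω ↦ f k ω - f (k + 1) ω) = fun ω ↦ f (k + 1) ω - f k ω by
      funext ω; simp]
  have hsum : ∀ m, eLpNorm (fun ω ↦ f n ω - f (n + m) ω) 2 P ≤
      ENNReal.ofReal (∑ k ∈ Finset.range m, √C * √q ^ (n + k)) := fun m ↦ by
    induction m with
    | zero => simp
    | succ m ih =>
      rw [Finset.sum_range_succ, ENNReal.ofReal_add (Finset.sum_nonneg fun _ _ ↦ by positivity)
        (by positivity)]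
      have e : (fun ω ↦ f n ω - f (n + (m + 1)) ω) =
          (fun ω ↦ f n ω - f (n + m) ω) + fun ω ↦ f (n + m) ω - f (n + m + 1) ω := by
        funext ω; simp [add_assoc]
      rw [e]
      exact (eLpNorm_add_le ((hf _).sub (hf _)) ((hf _).sub (hf _)) (by norm_num)).trans
        (add_le_add ih (hstep _))
  have hbd : ∀ m, eLpNorm (fun ω ↦ f n ω - f (n + m) ω) 2 P ≤
      ENNReal.ofReal (√C * (√q ^ n / (1 - √q))) := fun m ↦ by
    refine (hsum m).trans (ENNReal.ofReal_le_ofReal ?_)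
    rw [← Finset.mul_sum]
    simp_rw [pow_add]
    rw [← Finset.mul_sum, div_eq_mul_inv, ← tsum_geometric_of_lt_one hr0 hr1]
    gcongr
    exact (summable_geometric_of_lt_one hr0 hr1).sum_le_tsum _ fun _ _ ↦ by positivity
  have hlim : ∀ᵐ ω ∂P, Tendsto (fun m ↦ f n ω - f (n + m) ω) atTop (𝓝 (f n ω - g ω)) := by
    filter_upwards [hg] with ω hω
    refine tendsto_const_nhds.sub ?_
    simpa only [add_comm] using (tendsto_add_atTop_iff_nat n).2 hω
  refine (Lp.eLpNorm_lim_le_liminf_eLpNorm (fun m ↦ (hf _).sub (hf _)) _ hlim).trans ?_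
  exact liminf_le_of_le (by isBoundedDefault) fun b hb ↦ by
    obtain ⟨m, hm⟩ := hb.exists
    exact hm.trans (hbd m)

theorem lintegral_enorm_add_sq_le (f g : Ω → E) (hf : AEStronglyMeasurable f P) {a b : ℝ} (ha : 0 ≤ a)
    (hb : 0 ≤ b) (h : ∫⁻ ω, ‖f ω‖ₑ ^ 2 ∂P ≤ ENNReal.ofReal a)
    (h' : ∫⁻ ω, ‖g ω‖ₑ ^ 2 ∂P ≤ ENNReal.ofReal b) :
    ∫⁻ ω, ‖f ω + g ω‖ₑ ^ 2 ∂P ≤ ENNReal.ofReal (2 * a + 2 * b) := by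
  have h1 : ∀ ω, ‖f ω + g ω‖ₑ ^ 2 ≤ 2 * ‖f ω‖ₑ ^ 2 + 2 * ‖g ω‖ₑ ^ 2 := fun ω ↦ by
    have h2 : ‖f ω + g ω‖₊ ^ 2 ≤ 2 * ‖f ω‖₊ ^ 2 + 2 * ‖g ω‖₊ ^ 2 := by
      rw [← NNReal.coe_le_coe]
      push_cast
      have := norm_add_le (f ω) (g ω)
      nlinarith [norm_nonneg (f ω + g ω), sq_nonneg (‖f ω‖ - ‖g ω‖)]
    simp only [enorm_eq_nnnorm]
    exact_mod_cast h2
  refine (lintegral_mono h1).trans ?_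
  rw [lintegral_add_left' ((hf.enorm.pow_const 2).const_mul 2), lintegral_const_mul' _ _ (by simp),
    lintegral_const_mul' _ _ (by simp), ENNReal.ofReal_add (by positivity) (by positivity),
    ENNReal.ofReal_mul (by norm_num), ENNReal.ofReal_mul (by norm_num)]
  norm_num
  gcongr

end Geometric

/-! ### Convergence of the approximating fields -/

section Field

variable {Ω : Type*} [MeasurableSpace Ω] {P : Measure Ω} {V : ℝ → Ω → ℂ}

theorem measurable_uncurry_field (hV : HasOrthogonalIncrements V P) (s : ℝ) (N R : ℕ) :
    Measurable (Function.uncurry (field V s N R)) := by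
  unfold field Function.uncurry
  refine Finset.measurable_sum _ fun k _ ↦ Measurable.mul ?_ ?_
  · exact ((hV.measurable _).comp measurable_fst).sub ((hV.measurable _).comp measurable_fst)
  · have : Continuous fun x : ℝ ↦ profile s x ((k : ℝ) / N) := by unfold profile; fun_prop
    exact this.measurable.comp measurable_snd

theorem measurable_field (hV : HasOrthogonalIncrements V P) (s : ℝ) (N R : ℕ) (x : ℝ) :
    Measurable fun ω ↦ field V s N R ω x :=
  (measurable_uncurry_field hV s N R).comp (measurable_id.prodMk measurable_const)

theorem lintegral_field_step (hV : HasOrthogonalIncrements V P) (R n : ℕ) (x : ℝ) :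
    ∫⁻ ω, ‖field V 0 (2 ^ (n + 1)) R ω x - field V 0 (2 ^ n) R ω x‖ₑ ^ 2 ∂P ≤
      ENNReal.ofReal (2 * R * (1 + x ^ 2) * (1 / 4) ^ n) := by
  have := lintegral_field_two_mul_sub hV (s := 0) (by norm_num) (N := 2 ^ n) (by positivity) R x
  rw [pow_succ' 2 n]
  refine this.trans (le_of_eq ?_)
  congr 1
  push_cast
  rw [← pow_mul, mul_comm n, pow_mul, one_div, inv_pow]
  norm_num
  ring

/-- With `s = 0` the tail is compared with the sum of `2N / j²` over `j ≥ NR`, which is at most `4 /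
R` whatever the mesh. -/
theorem lintegral_field_tail (hV : HasOrthogonalIncrements V P) {N R R' : ℕ} (hN : N ≠ 0)
    (hR : R ≠ 0) (hR' : R ≤ R') (x : ℝ) :
    ∫⁻ ω, ‖field V 0 N R' ω x - field V 0 N R ω x‖ₑ ^ 2 ∂P ≤ ENNReal.ofReal (4 / R) := by
  rw [lintegral_field_sub hV 0 N hR' x]
  refine ENNReal.ofReal_le_ofReal ?_
  have hN' : (0 : ℝ) < N := by exact_mod_cast Nat.pos_of_ne_zero hN
  have hR0 : (0 : ℝ) < R := by exact_mod_cast Nat.pos_of_ne_zero hR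
  have hNR : 0 < N * R := by positivity
  have h1 : ∀ j ∈ Finset.Ico (N * R) (N * R'),
      ((1 + ((j : ℝ) / N) ^ 2) ^ ((0 : ℝ) - 1) + (1 + (((j : ℝ) + 1) / N) ^ 2) ^ ((0 : ℝ) - 1)) *
          (1 / N) ≤ 2 * N * ((j : ℝ) ^ 2)⁻¹ := fun j hj ↦ by
    have hj0 : (0 : ℝ) < j := by
      exact_mod_cast hNR.trans_le (Finset.mem_Ico.1 hj).1
    have h2 : ∀ t : ℝ, (j : ℝ) ≤ t → (1 + (t / N) ^ 2) ^ ((0 : ℝ) - 1) ≤ N ^ 2 * ((j : ℝ) ^ 2)⁻¹ :=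
      fun t ht ↦ by
      rw [zero_sub, Real.rpow_neg_one,
        show (N : ℝ) ^ 2 * ((j : ℝ) ^ 2)⁻¹ = (((j : ℝ) / N) ^ 2)⁻¹ by field_simp]
      refine inv_anti₀ (by positivity) ?_
      have : (j : ℝ) / N ≤ t / N := by gcongr
      have : ((j : ℝ) / N) ^ 2 ≤ (t / N) ^ 2 := by gcongr
      linarith
    calc _ ≤ (N ^ 2 * ((j : ℝ) ^ 2)⁻¹ + N ^ 2 * ((j : ℝ) ^ 2)⁻¹) * (1 / N) := by
          gcongr
          · exact h2 _ le_rfl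
          · exact h2 _ (by linarith)
      _ = _ := by field_simp; ring
  refine (Finset.sum_le_sum h1).trans ?_
  rw [← Finset.mul_sum]
  have h3 : Finset.Ico (N * R) (N * R') = Finset.Ioo (N * R - 1) (N * R') := by
    ext j; simp only [Finset.mem_Ico, Finset.mem_Ioo]; omega
  rw [h3]
  have h4 := sum_Ioo_inv_sq_le (α := ℝ) (N * R - 1) (N * R')
  have h5 : ((N * R - 1 : ℕ) : ℝ) + 1 = N * R := by
    have : N * R - 1 + 1 = N * R := Nat.sub_add_cancel hNR
    exact_mod_cast this
  rw [h5] at h4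
  calc _ ≤ 2 * (N : ℝ) * (2 / (N * R)) := by gcongr
    _ = _ := by field_simp; norm_num

/-- Going from `2 ^ n` to `2 ^ (n + 1)` first enlarges the range at the fine mesh, then compares
meshes on the old range. The new frequencies have total length `2 · 2 ^ n` and weight at most `4 ^
((s - 1) n)`, which gives the ratio `2 · 4 ^ (s - 1)`, below `1` precisely for `s < 1/2`. The change
of mesh gives `R / N² = 2 ^ (-n)`. -/
theorem exists_lintegral_field_diagonal (hV : HasOrthogonalIncrements V P) {s : ℝ}
    (hs : s < 1 / 2) : ∃ C q : ℝ, 0 ≤ C ∧ 0 ≤ q ∧ q < 1 ∧ ∀ (n : ℕ) (x : ℝ),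
      ∫⁻ ω, ‖field V s (2 ^ (n + 1)) (2 ^ (n + 1)) ω x - field V s (2 ^ n) (2 ^ n) ω x‖ₑ ^ 2 ∂P ≤
        ENNReal.ofReal (C * (1 + x ^ 2) * q ^ n) := by
  set q₁ : ℝ := 2 * 4 ^ (s - 1) with hq₁
  have hq₁1 : q₁ < 1 := by
    have : (4 : ℝ) ^ (s - 1) < 4 ^ (-(1 / 2) : ℝ) :=
      Real.rpow_lt_rpow_of_exponent_lt (by norm_num) (by linarith)
    have h4 : (4 : ℝ) ^ (-(1 / 2) : ℝ) = 1 / 2 := by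
      rw [Real.rpow_neg (by norm_num), ← Real.sqrt_eq_rpow, show (4 : ℝ) = 2 ^ 2 by norm_num,
        Real.sqrt_sq (by norm_num)]
      norm_num
    rw [h4] at this
    linarith
  have hq₁0 : 0 ≤ q₁ := by positivity
  set q := max q₁ (1 / 2)
  refine ⟨2 * 2 + 2 * ((s - 1) ^ 2 + 1), q, by positivity, by positivity,
    max_lt hq₁1 (by norm_num), fun n x ↦ ?_⟩
  have hA : ∫⁻ ω, ‖field V s (2 ^ (n + 1)) (2 ^ (n + 1)) ω x -
      field V s (2 ^ (n + 1)) (2 ^ n) ω x‖ₑ ^ 2 ∂P ≤ ENNReal.ofReal (2 * q₁ ^ n) := by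
    rw [lintegral_field_sub hV s _ (Nat.pow_le_pow_right (by norm_num) n.le_succ)]
    refine ENNReal.ofReal_le_ofReal ?_
    set N : ℕ := 2 ^ (n + 1) with hN
    have hN0 : (0 : ℝ) < N := by positivity
    have h2 : ∀ t : ℝ, (2 : ℝ) ^ n ≤ t → (1 + t ^ 2) ^ (s - 1) ≤ ((4 : ℝ) ^ (s - 1)) ^ n :=
      fun t ht ↦ by
      have e : ((4 : ℝ) ^ (s - 1)) ^ n = ((4 : ℝ) ^ n) ^ (s - 1) := by
        rw [← Real.rpow_natCast, ← Real.rpow_mul (by norm_num), mul_comm,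
          Real.rpow_mul (by norm_num), Real.rpow_natCast]
      rw [e]
      refine Real.rpow_le_rpow_of_nonpos (by positivity) ?_ (by linarith)
      have : ((2 : ℝ) ^ n) ^ 2 ≤ t ^ 2 := by gcongr
      rw [← pow_mul, mul_comm n, pow_mul] at this
      norm_num at this
      linarith
    calc _ ≤ ∑ j ∈ Finset.Ico (N * 2 ^ n) (N * 2 ^ (n + 1)),
          (((4 : ℝ) ^ (s - 1)) ^ n + ((4 : ℝ) ^ (s - 1)) ^ n) * (1 / N) := by
          refine Finset.sum_le_sum fun j hj ↦ ?_
          have hj : (2 : ℝ) ^ n ≤ j / N := by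
            rw [le_div_iff₀ hN0, mul_comm]
            exact_mod_cast (Finset.mem_Ico.1 hj).1
          gcongr
          · exact h2 _ hj
          · refine h2 _ (hj.trans ?_)
            gcongr
            linarith
      _ = _ := by
          rw [Finset.sum_const, Nat.card_Ico, nsmul_eq_mul, pow_succ 2 n, hq₁, mul_pow,
            show N * (2 ^ n * 2) - N * 2 ^ n = N * 2 ^ n by
              rw [mul_two, mul_add, Nat.add_sub_cancel]]
          push_cast
          field_simp
          ring
  have hB : ∫⁻ ω, ‖field V s (2 ^ (n + 1)) (2 ^ n) ω x - field V s (2 ^ n) (2 ^ n) ω x‖ₑ ^ 2 ∂P ≤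
      ENNReal.ofReal (((s - 1) ^ 2 + 1) * (1 + x ^ 2) * (1 / 2) ^ n) := by
    have := lintegral_field_two_mul_sub hV (s := s) (by linarith) (N := 2 ^ n) (by positivity)
      (2 ^ n) x
    rw [pow_succ' 2 n]
    refine this.trans (le_of_eq ?_)
    congr 1
    push_cast
    rw [one_div, inv_pow]
    field_simp
  have hAB := lintegral_enorm_add_sq_le
    (fun ω ↦ field V s (2 ^ (n + 1)) (2 ^ (n + 1)) ω x - field V s (2 ^ (n + 1)) (2 ^ n) ω x)
    (fun ω ↦ field V s (2 ^ (n + 1)) (2 ^ n) ω x - field V s (2 ^ n) (2 ^ n) ω x)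
    ((measurable_field hV _ _ _ x).sub
    (measurable_field hV _ _ _ x)).aestronglyMeasurable (by positivity) (by positivity) hA hB
  simp only [sub_add_sub_cancel] at hAB
  refine hAB.trans (ENNReal.ofReal_le_ofReal ?_)
  have b1 : q₁ ^ n ≤ q ^ n := by gcongr; exact le_max_left _ _
  have b2 : (1 / 2 : ℝ) ^ n ≤ q ^ n := by gcongr; exact le_max_right _ _
  have b3 : q₁ ^ n ≤ (1 + x ^ 2) * q ^ n := by
    nlinarith [mul_nonneg (sq_nonneg x) (pow_nonneg hq₁0 n), sq_nonneg x]
  have b4 : ((s - 1) ^ 2 + 1) * (1 + x ^ 2) * (1 / 2) ^ n ≤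
      ((s - 1) ^ 2 + 1) * (1 + x ^ 2) * q ^ n := by gcongr
  linarith

end Field

/-! ### Trigonometric polynomials and their limits in `H^{1/2-}_loc` -/

theorem weighted_apply (G : Lp ℂ 2 (volume : Measure ℝ)) (f : 𝓢(ℝ, ℂ)) :
    weighted G f = ∫ x, f x * (weight x * G x) := by
  change (G : 𝓢'(ℝ, ℂ)) (SchwartzMap.smulLeftCLM ℂ weight f) = _
  rw [Lp.toTemperedDistribution_apply]
  refine integral_congr_ae (ae_of_all _ fun x ↦ ?_)
  simp only [SchwartzMap.smulLeftCLM_apply_apply weight_hasTemperateGrowth, smul_eq_mul]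
  ring

theorem IsLocL2Fun.congr {T : 𝓢'(ℝ, ℂ)} {g h : ℝ → ℂ} (hT : IsLocL2Fun T g)
    (hgh : g =ᵐ[volume] h) : IsLocL2Fun T h := by
  refine ⟨fun R ↦ (memLp_congr_ae (ae_restrict_of_ae hgh)).1 (hT.1 R), fun f hf ↦ ?_⟩
  rw [hT.2 f hf]
  refine integral_congr_ae ?_
  filter_upwards [hgh] with x hx
  rw [hx]

theorem norm_weight (x : ℝ) : ‖weight x‖ = 1 + x ^ 2 := by
  rw [weight, Complex.norm_real, Real.norm_of_nonneg (by positivity)]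

theorem continuous_weight : Continuous weight := weight_hasTemperateGrowth.1.continuous

theorem memLp_inv_weight_mul {g : ℝ → ℂ} (hg : Continuous g) {C : ℝ} (hC : ∀ x, ‖g x‖ ≤ C) :
    MemLp (fun x ↦ (weight x)⁻¹ * g x) 2 volume := by
  have hc : Continuous fun x ↦ (weight x)⁻¹ := continuous_weight.inv₀ weight_ne_zero
  have h1 : MemLp (fun x ↦ (weight x)⁻¹) 2 volume := by
    rw [memLp_two_iff_integrable_sq_norm hc.aestronglyMeasurable]
    refine integrable_inv_one_add_sq.mono' (hc.norm.pow 2).aestronglyMeasurable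
      (ae_of_all _ fun x ↦ ?_)
    rw [norm_inv, norm_weight, Real.norm_of_nonneg (by positivity), inv_pow]
    refine inv_anti₀ (by positivity) ?_
    nlinarith [sq_nonneg x, sq_nonneg (x ^ 2)]
  refine MemLp.of_le_mul (c := C) h1 (hc.mul hg).aestronglyMeasurable (ae_of_all _ fun x ↦ ?_)
  rw [norm_mul, mul_comm]
  exact mul_le_mul_of_nonneg_right (hC x) (norm_nonneg _)

namespace HLoc

theorem fracD_sum_wave (s : ℝ) {ι : Type*} (I : Finset ι) (c : ι → ℂ) (κ : ι → ℝ)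
    (f : 𝓢(ℝ, ℂ)) :
    fracD s (toDist (∑ k ∈ I, c k • wave (κ k))) f =
      ∫ x, f x * ∑ k ∈ I, c k * ((((1 + κ k ^ 2) ^ (s / 2) : ℝ) : ℂ) *
        Complex.exp (Complex.I * ((κ k * x : ℝ) : ℂ))) := by
  have hint : ∀ k, Integrable fun x ↦ f x * (c k * ((((1 + κ k ^ 2) ^ (s / 2) : ℝ) : ℂ) *
      Complex.exp (Complex.I * ((κ k * x : ℝ) : ℂ)))) := fun k ↦ by
    refine f.integrable.mul_bdd (c := ‖c k‖ * ‖(((1 + κ k ^ 2) ^ (s / 2) : ℝ) : ℂ)‖) (by fun_prop)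
      (ae_of_all _ fun x ↦ ?_)
    rw [norm_mul, norm_mul, mul_comm Complex.I, Complex.norm_exp_ofReal_mul_I, mul_one]
  simp_rw [Finset.mul_sum]
  rw [integral_finsetSum _ fun k _ ↦ hint k, map_sum, map_sum]
  have h1 : ∀ T : ι → 𝓢'(ℝ, ℂ), (∑ k ∈ I, T k) f = ∑ k ∈ I, T k f := fun T ↦ by
    simp
  rw [h1]
  refine Finset.sum_congr rfl fun k _ ↦ ?_
  rw [map_smul, map_smul, toDist_wave, fracD_planeWave, smul_smul]
  have h2 : ∀ (z : ℂ) (T : 𝓢'(ℝ, ℂ)), (z • T) f = z * T f := fun _ _ ↦ rfl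
  rw [h2, planeWave_apply, ← integral_const_mul]
  refine integral_congr_ae (ae_of_all _ fun x ↦ ?_)
  simp only
  ring

/-- A sequence in `H^{1/2-}_loc` converges if all `D ^ s` with `s = 1/2 - 1/l` of it converge in
`(1 + x ^ 2) L²`. -/
theorem exists_tendsto_of_weighted {u : ℕ → HLoc} {H : ℕ+ → ℕ → Lp ℂ 2 (volume : Measure ℝ)}
    {G : ℕ+ → Lp ℂ 2 (volume : Measure ℝ)}
    (hu : ∀ l n, fracD (expo l) (toDist (u n)) = weighted (H l n))
    (hH : ∀ l, Tendsto (H l) atTop (𝓝 (G l))) :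
    ∃ v : HLoc, toDist v = weighted (G 2) ∧ Tendsto u atTop (𝓝 v) := by
  have h0 : ((expo 2 : Set.Iio (1 / 2 : ℝ)) : ℝ) = 0 := by simp [expo]
  -- The limits for different exponents are compatible because `D ^ s` is continuous on tempered
  -- distributions, where limits are unique.
  have h2 : ∀ l, fracD (expo l) (weighted (G 2)) = weighted (G l) := fun l ↦ by
    have a1 : Tendsto (fun n ↦ fracD (expo l) (weighted (H 2 n))) atTop
        (𝓝 (fracD (expo l) (weighted (G 2)))) :=
      (((fracD (expo l)).continuous.comp weighted.continuous).tendsto _).comp (hH 2)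
    have a2 : Tendsto (fun n ↦ weighted (H l n)) atTop (𝓝 (weighted (G l))) :=
      (weighted.continuous.tendsto _).comp (hH l)
    refine tendsto_nhds_unique a1 (a2.congr fun n ↦ ?_)
    rw [← hu, ← hu, h0, fracD_zero]
  let v : HLoc := (⟨weighted (G 2), mem_hLocSubmodule fun l ↦ ⟨G l, h2 l⟩⟩ : hLocSubmodule)
  have hv : toDist v = weighted (G 2) := rfl
  refine ⟨v, hv, tendsto_of_seminorm fun R l ↦ ?_⟩
  have h3 : ∀ n, fracD (expo l) (toDist (u n - v)) = weighted (H l n - G l) := fun n ↦ by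
    rw [map_sub, map_sub, hu, hv, h2, map_sub]
  have h4 : ∀ n, seminorm (R : ℝ) (expo l) (u n - v) ≤ (1 + (R : ℝ) ^ 2) * ‖H l n - G l‖ :=
    fun n ↦ by
    have hl : IsLocL2Fun (fracD (expo l) (toDist (u n - v)))
        (fun x ↦ weight x * (H l n - G l : Lp ℂ 2 (volume : Measure ℝ)) x) := by
      rw [h3]; exact weighted_isLocL2Fun _
    rw [seminorm_eq _ _ hl, Lp.norm_def]
    have hb := eLpNorm_le_mul_eLpNorm_of_ae_le_mul (p := 2)
      (μ := volume.restrict (Set.Icc (-(R : ℝ)) R)) (c := 1 + (R : ℝ) ^ 2)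
      (f := fun x ↦ weight x * (H l n - G l : Lp ℂ 2 (volume : Measure ℝ)) x)
      (g := (H l n - G l : Lp ℂ 2 (volume : Measure ℝ)))
      ((ae_restrict_iff' measurableSet_Icc).2 (ae_of_all _ fun x hx ↦ by
        rw [norm_mul, norm_weight]
        have : x ^ 2 ≤ (R : ℝ) ^ 2 := sq_le_sq' hx.1 hx.2
        gcongr))
    have hb' := hb.trans (mul_le_mul_right (eLpNorm_restrict_le _ _ _ _) _)
    refine (ENNReal.toReal_mono (ENNReal.mul_ne_top ENNReal.ofReal_ne_top
      (Lp.eLpNorm_ne_top _)) hb').trans (le_of_eq ?_)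
    rw [ENNReal.toReal_mul, ENNReal.toReal_ofReal (by positivity)]
  have h5 : Tendsto (fun n ↦ (1 + (R : ℝ) ^ 2) * ‖H l n - G l‖) atTop (𝓝 0) := by
    have := (tendsto_iff_norm_sub_tendsto_zero.1 (hH l)).const_mul (1 + (R : ℝ) ^ 2)
    simpa using this
  exact squeeze_zero (fun n ↦ apply_nonneg _ _) h4 h5

end HLoc

/-! ### The random field of a process with orthogonal increments -/

section Field

variable {Ω : Type*} [MeasurableSpace Ω] {P : Measure Ω} {V : ℝ → Ω → ℂ}

/-- The approximation of `φ` as an element of `H^{1/2-}_loc`. -/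
noncomputable def fieldHLoc {Ω : Type*} (V : ℝ → Ω → ℂ) (N R : ℕ) (ω : Ω) : HLoc :=
  ∑ k ∈ Finset.Ico (-((N * R : ℕ) : ℤ)) ((N * R : ℕ) : ℤ),
    ((V (((k : ℝ) + 1) / N) ω - V ((k : ℝ) / N) ω) *
      (((1 + ((k : ℝ) / N) ^ 2) ^ (-1 / 2 : ℝ) : ℝ) : ℂ)) • HLoc.wave ((k : ℝ) / N)

theorem measurable_fieldHLoc (hV : HasOrthogonalIncrements V P) (N R : ℕ) :
    Measurable (fieldHLoc V N R) :=
  HLoc.measurable_sum_smul _ _ fun _ ↦ ((hV.measurable _).sub (hV.measurable _)).mul_const _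

theorem memLp_field {Ω : Type*} (V : ℝ → Ω → ℂ) (s : ℝ) (N R : ℕ) (ω : Ω) :
    MemLp (fun x ↦ (weight x)⁻¹ * field V s N R ω x) 2 volume := by
  refine memLp_inv_weight_mul (C := ∑ k ∈ Finset.Ico (-((N * R : ℕ) : ℤ)) ((N * R : ℕ) : ℤ),
    ‖V (((k : ℝ) + 1) / N) ω - V ((k : ℝ) / N) ω‖ *
      ‖(((1 + ((k : ℝ) / N) ^ 2) ^ ((s - 1) / 2) : ℝ) : ℂ)‖) ?_ fun x ↦ ?_
  · unfold field profile
    fun_prop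
  · refine (norm_sum_le _ _).trans (le_of_eq (Finset.sum_congr rfl fun k _ ↦ ?_))
    rw [norm_mul, profile, norm_mul, mul_comm Complex.I, Complex.norm_exp_ofReal_mul_I, mul_one]

/-- The approximation of `D ^ s φ`, divided by `1 + x ^ 2`, in `L²`. -/
noncomputable def fieldLp {Ω : Type*} (V : ℝ → Ω → ℂ) (s : ℝ) (N R : ℕ) (ω : Ω) :
    Lp ℂ 2 (volume : Measure ℝ) :=
  (memLp_field V s N R ω).toLp

theorem fracD_fieldHLoc {Ω : Type*} (V : ℝ → Ω → ℂ) (s : ℝ) (N R : ℕ) (ω : Ω) :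
    fracD s (HLoc.toDist (fieldHLoc V N R ω)) = weighted (fieldLp V s N R ω) := by
  ext f
  rw [fieldHLoc, HLoc.fracD_sum_wave, weighted_apply]
  refine integral_congr_ae ?_
  filter_upwards [(memLp_field V s N R ω).coeFn_toLp] with x hx
  rw [fieldLp, hx, mul_inv_cancel_left₀ (weight_ne_zero x), field]
  congr 1
  refine Finset.sum_congr rfl fun k _ ↦ ?_
  rw [profile, mul_assoc, ← mul_assoc (Complex.ofReal _) (Complex.ofReal _), ← Complex.ofReal_mul,
    ← Real.rpow_add (by positivity)]
  congr 5
  ring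

theorem lintegral_inv_one_add_sq :
    ∫⁻ x : ℝ, ENNReal.ofReal (1 + x ^ 2)⁻¹ = ENNReal.ofReal Real.pi := by
  rw [← ofReal_integral_eq_lintegral_ofReal integrable_inv_one_add_sq
    (ae_of_all _ fun x ↦ by positivity), integral_univ_inv_one_add_sq]

/-- By Tonelli, the squared factor `(1 + x²)⁻²` against the growth `1 + x²` leaves `(1 + x²)⁻¹`, of
integral `π`. The squared norms of the increments thus have geometric expectation. -/
theorem ae_exists_tendsto_fieldLp [IsProbabilityMeasure P] (hV : HasOrthogonalIncrements V P)
    {s : ℝ} (hs : s < 1 / 2) :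
    ∀ᵐ ω ∂P, ∃ G, Tendsto (fun n : ℕ ↦ fieldLp V s (2 ^ n) (2 ^ n) ω) atTop (𝓝 G) := by
  obtain ⟨C, q, hC, hq0, hq1, h⟩ := exists_lintegral_field_diagonal hV hs
  set d : ℕ → Ω → ℝ → ℂ := fun n ω x ↦ (weight x)⁻¹ *
    (field V s (2 ^ (n + 1)) (2 ^ (n + 1)) ω x - field V s (2 ^ n) (2 ^ n) ω x) with hd
  have hdm : ∀ n, Measurable (Function.uncurry (d n)) := fun n ↦
    ((continuous_weight.measurable.comp measurable_snd).inv).mul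
      ((measurable_uncurry_field hV _ _ _).sub (measurable_uncurry_field hV _ _ _))
  have hnorm : ∀ n ω, ‖fieldLp V s (2 ^ (n + 1)) (2 ^ (n + 1)) ω - fieldLp V s (2 ^ n) (2 ^ n) ω‖ₑ =
      eLpNorm (d n ω) 2 volume := fun n ω ↦ by
    rw [fieldLp, fieldLp, ← MemLp.toLp_sub, Lp.enorm_toLp]
    congr 1
    funext x
    simp [hd, mul_sub]
  have hsq : ∀ n ω, eLpNorm (d n ω) 2 volume ^ 2 = ∫⁻ x, ‖d n ω x‖ₑ ^ 2 := fun n ω ↦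
    eLpNorm_two_sq _ _
  have hm2 : ∀ n, Measurable fun ω ↦ eLpNorm (d n ω) 2 volume := fun n ↦ by
    have h1 : Measurable fun ω ↦ ∫⁻ x, ‖d n ω x‖ₑ ^ 2 :=
      ((hdm n).enorm.pow_const 2).lintegral_prod_right'
    have h2 : (fun ω ↦ eLpNorm (d n ω) 2 volume) =
        fun ω ↦ (∫⁻ x, ‖d n ω x‖ₑ ^ 2) ^ (1 / 2 : ℝ) := by
      funext ω
      rw [← hsq, ← ENNReal.rpow_natCast, ← ENNReal.rpow_mul]
      norm_num
    rw [h2]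
    exact h1.pow_const _
  have hbd : ∀ n, ∫⁻ ω, eLpNorm (d n ω) 2 volume ^ 2 ∂P ≤
      ENNReal.ofReal (C * Real.pi * q ^ n) := fun n ↦ by
    simp_rw [hsq]
    rw [lintegral_lintegral_swap ((hdm n).enorm.pow_const 2).aemeasurable]
    calc _ ≤ ∫⁻ x : ℝ, ENNReal.ofReal (C * q ^ n) * ENNReal.ofReal (1 + x ^ 2)⁻¹ := by
          refine lintegral_mono fun x ↦ ?_
          have e1 : ∀ ω, ‖d n ω x‖ₑ ^ 2 = ENNReal.ofReal ((1 + x ^ 2)⁻¹ ^ 2) *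
              ‖field V s (2 ^ (n + 1)) (2 ^ (n + 1)) ω x - field V s (2 ^ n) (2 ^ n) ω x‖ₑ ^ 2 :=
            fun ω ↦ by
            rw [hd, enorm_mul, mul_pow, ← ofReal_norm (weight x)⁻¹, norm_inv, norm_weight,
              ENNReal.ofReal_pow (by positivity)]
          simp_rw [e1]
          rw [lintegral_const_mul' _ _ ENNReal.ofReal_ne_top, ← ENNReal.ofReal_mul (by positivity)]
          refine (mul_le_mul_right (h n x) _).trans ?_
          rw [← ENNReal.ofReal_mul (by positivity)]
          refine ENNReal.ofReal_le_ofReal (le_of_eq ?_)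
          field_simp
      _ = _ := by
          rw [lintegral_const_mul' _ _ ENNReal.ofReal_ne_top, lintegral_inv_one_add_sq,
            ← ENNReal.ofReal_mul (by positivity)]
          congr 1
          ring
  filter_upwards [ae_tsum_ne_top (fun n ↦ (hm2 n).aemeasurable) (by positivity) hq0 hq1 hbd]
    with ω hω
  exact exists_tendsto_of_tsum_enorm_ne_top (by simpa only [hnorm] using hω)

end Field

/-! ### Existence of the limit field -/

section Field

variable {Ω : Type*} [MeasurableSpace Ω] {P : Measure Ω} {V : ℝ → Ω → ℂ}

theorem weightedNorm_le {f : Ω → ℝ → ℂ} {B : ℝ≥0∞}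
    (h : ∀ x, eLpNorm (fun ω ↦ f ω x) 2 P ≤ ENNReal.ofReal (√(1 + x ^ 2)) * B) :
    weightedNorm P f ≤ B := by
  refine essSup_le_of_ae_le _ (ae_of_all _ fun x ↦ ?_)
  have hx : 0 < √(1 + x ^ 2) := Real.sqrt_pos.2 (by positivity)
  refine (mul_le_mul_right (h x) _).trans ?_
  rw [← mul_assoc, ← ENNReal.ofReal_mul (by positivity), inv_mul_cancel₀ hx.ne']
  simp

theorem weightedNorm_congr {f g : Ω → ℝ → ℂ} (h : ∀ᵐ ω ∂P, ∀ x, f ω x = g ω x) :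
    weightedNorm P f = weightedNorm P g := by
  unfold weightedNorm
  congr 1
  funext x
  congr 1
  exact eLpNorm_congr_ae (h.mono fun ω hω ↦ hω x)

theorem ae_tendsto_limUnder [IsProbabilityMeasure P] {f : ℕ → Ω → ℝ → ℂ}
    (hf : ∀ n x, Measurable fun ω ↦ f n ω x) {C q : ℝ} (hC : 0 ≤ C) (hq0 : 0 ≤ q) (hq1 : q < 1)
    (h : ∀ n x, ∫⁻ ω, ‖f (n + 1) ω x - f n ω x‖ₑ ^ 2 ∂P ≤
      ENNReal.ofReal (C * (1 + x ^ 2) * q ^ n)) (x : ℝ) :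
    ∀ᵐ ω ∂P, Tendsto (fun n ↦ f n ω x) atTop (𝓝 (limUnder atTop fun n ↦ f n ω x)) := by
  filter_upwards [ae_tsum_ne_top
    (fun n ↦ ((hf (n + 1) x).sub (hf n x)).enorm.aemeasurable) (by positivity) hq0 hq1
    (fun n ↦ h n x)] with ω hω
  exact tendsto_nhds_limUnder (exists_tendsto_of_tsum_enorm_ne_top hω)

theorem tendsto_weightedNorm_limUnder [IsProbabilityMeasure P] {f : ℕ → Ω → ℝ → ℂ}
    (hf : ∀ n x, Measurable fun ω ↦ f n ω x) {C q : ℝ} (hC : 0 ≤ C) (hq0 : 0 ≤ q) (hq1 : q < 1)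
    (h : ∀ n x, ∫⁻ ω, ‖f (n + 1) ω x - f n ω x‖ₑ ^ 2 ∂P ≤
      ENNReal.ofReal (C * (1 + x ^ 2) * q ^ n)) :
    Tendsto (fun n ↦ weightedNorm P fun ω x ↦ f n ω x - limUnder atTop fun n ↦ f n ω x) atTop
      (𝓝 0) := by
  have hr1 : √q < 1 := by rw [Real.sqrt_lt' one_pos]; simpa using hq1
  have hb : ∀ n, weightedNorm P (fun ω x ↦ f n ω x - limUnder atTop fun n ↦ f n ω x) ≤
      ENNReal.ofReal (√C * (√q ^ n / (1 - √q))) := fun n ↦ by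
    refine weightedNorm_le fun x ↦ ?_
    refine (eLpNorm_sub_le_geometric (fun n ↦ (hf n x).aestronglyMeasurable) (by positivity) hq0
      hq1 (fun n ↦ h n x) (ae_tendsto_limUnder hf hC hq0 hq1 h x) n).trans (le_of_eq ?_)
    rw [← ENNReal.ofReal_mul (by positivity), Real.sqrt_mul hC]
    congr 1
    ring
  have hlim : Tendsto (fun n : ℕ ↦ ENNReal.ofReal (√C * (√q ^ n / (1 - √q)))) atTop (𝓝 0) := by
    have := (((tendsto_pow_atTop_nhds_zero_of_lt_one (Real.sqrt_nonneg q) hr1).div_const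
      (1 - √q)).const_mul √C)
    rw [zero_div, mul_zero] at this
    simpa only [ENNReal.ofReal_zero] using ENNReal.tendsto_ofReal this
  exact tendsto_of_tendsto_of_tendsto_of_le_of_le tendsto_const_nhds hlim (fun _ ↦ zero_le) hb

/-- The field is built as the diagonal limit, which is also the one that converges in
`H^{1/2-}_loc`. The iterated limit is recovered by comparing with range `R` at the same mesh `2 ^
n`, where the tail bound is uniform in `n`. Pointwise `limUnder` keeps everything jointly
measurable. -/
theorem exists_isLimitField [IsProbabilityMeasure P] (hV : HasOrthogonalIncrements V P) :
    ∃ φ : Ω → ℝ → ℂ, IsLimitField V P φ ∧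
      ∀ᵐ ω ∂P, ∀ᵐ x, Tendsto (fun n : ℕ ↦ field V 0 (2 ^ n) (2 ^ n) ω x) atTop (𝓝 (φ ω x)) := by
  obtain ⟨C, q, hC, hq0, hq1, h⟩ := exists_lintegral_field_diagonal hV (s := 0) (by norm_num)
  have hlm : ∀ R : ℕ → ℕ, StronglyMeasurable (Function.uncurry fun ω x ↦
      limUnder atTop fun n ↦ field V 0 (2 ^ n) (R n) ω x) := fun R ↦
    StronglyMeasurable.limUnder (l := atTop)
      (f := fun n (p : Ω × ℝ) ↦ field V 0 (2 ^ n) (R n) p.1 p.2)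
      fun n ↦ (measurable_uncurry_field hV 0 (2 ^ n) (R n)).stronglyMeasurable
  have hφ := ae_tendsto_limUnder (f := fun n ω x ↦ field V 0 (2 ^ n) (2 ^ n) ω x)
    (fun n x ↦ measurable_field hV _ _ _ x) hC hq0 hq1 h
  have hψ := fun R ↦ ae_tendsto_limUnder (f := fun n ω x ↦ field V 0 (2 ^ n) R ω x)
    (fun n x ↦ measurable_field hV _ _ _ x) (C := 2 * R) (by positivity) (by norm_num)
    (by norm_num) (lintegral_field_step hV R)
  have hψ' := fun R ↦ tendsto_weightedNorm_limUnder (f := fun n ω x ↦ field V 0 (2 ^ n) R ω x)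
    (fun n x ↦ measurable_field hV _ _ _ x) (C := 2 * R) (by positivity) (by norm_num)
    (by norm_num) (lintegral_field_step hV R)
  refine ⟨fun ω x ↦ limUnder atTop fun n ↦ field V 0 (2 ^ n) (2 ^ n) ω x,
    ⟨(hlm fun n ↦ 2 ^ n).aestronglyMeasurable,
      fun R ω x ↦ limUnder atTop fun n ↦ field V 0 (2 ^ n) R ω x,
      fun R ↦ (hlm fun _ ↦ R).aestronglyMeasurable, fun R ↦ ?_, ?_⟩, ?_⟩
  · simpa only [approxField_eq_field] using hψ' R
  · have hb : ∀ R : ℕ, R ≠ 0 → weightedNorm P (fun ω x ↦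
        (limUnder atTop fun n ↦ field V 0 (2 ^ n) R ω x) -
          limUnder atTop fun n ↦ field V 0 (2 ^ n) (2 ^ n) ω x) ≤
        ENNReal.ofReal (√(4 / R)) := fun R hR ↦ by
      refine weightedNorm_le fun x ↦ ?_
      have hx : 1 ≤ √(1 + x ^ 2) := Real.one_le_sqrt.2 (by nlinarith [sq_nonneg x])
      refine le_trans ?_ (le_mul_of_one_le_left zero_le (ENNReal.one_le_ofReal.2 hx))
      refine Lp.eLpNorm_le_of_ae_tendsto (u := atTop)
        (f := fun n ω ↦ field V 0 (2 ^ n) R ω x - field V 0 (2 ^ n) (2 ^ n) ω x) ?_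
        (fun n ↦ ((measurable_field hV _ _ _ x).sub
          (measurable_field hV _ _ _ x)).aestronglyMeasurable) ?_
      · filter_upwards [eventually_ge_atTop R] with n hn
        refine eLpNorm_two_le (by positivity) ?_
        -- The diagonal range contains the range `R` once `n ≥ R`, since `n < 2 ^ n`.
        have := lintegral_field_tail hV (N := 2 ^ n) (by positivity) hR
          (hn.trans n.lt_two_pow_self.le) x
        refine le_trans (le_of_eq (lintegral_congr fun ω ↦ ?_)) this
        rw [enorm_sub_rev]
      · filter_upwards [hφ x, hψ R x] with ω h1 h2 using h2.sub h1
    have hlim : Tendsto (fun R : ℕ ↦ ENNReal.ofReal (√(4 / R))) atTop (𝓝 0) := by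
      have h1 : Tendsto (fun R : ℕ ↦ √(4 / R)) atTop (𝓝 (√0)) :=
        (Real.continuous_sqrt.tendsto 0).comp (tendsto_const_div_atTop_nhds_zero_nat 4)
      rw [Real.sqrt_zero] at h1
      simpa only [ENNReal.ofReal_zero] using ENNReal.tendsto_ofReal h1
    refine tendsto_of_tendsto_of_tendsto_of_le_of_le' tendsto_const_nhds hlim
      (Eventually.of_forall fun _ ↦ zero_le) ?_
    filter_upwards [eventually_ne_atTop 0] with R hR using hb R hR
  · have hm : MeasurableSet {p : Ω × ℝ | Tendsto (fun n : ℕ ↦ field V 0 (2 ^ n) (2 ^ n) p.1 p.2)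
        atTop (𝓝 (limUnder atTop fun n ↦ field V 0 (2 ^ n) (2 ^ n) p.1 p.2))} :=
      measurableSet_tendsto_fun (fun n ↦ measurable_uncurry_field hV 0 (2 ^ n) (2 ^ n))
        (hlm fun n ↦ 2 ^ n).measurable
    -- Fubini turns convergence almost surely for each `x` into convergence for almost every `x`,
    -- almost surely.
    exact (Measure.ae_ae_comm hm).2 (ae_of_all _ hφ)

/-- The limit field takes values in `H^{1/2-}_loc`. -/
theorem exists_hLoc_version [IsProbabilityMeasure P] (hV : HasOrthogonalIncrements V P)
    {φ : Ω → ℝ → ℂ}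
    (hφ : ∀ᵐ ω ∂P, ∀ᵐ x, Tendsto (fun n : ℕ ↦ field V 0 (2 ^ n) (2 ^ n) ω x) atTop
      (𝓝 (φ ω x))) :
    ∃ Φ : Ω → HLoc, AEMeasurable Φ P ∧ ∀ᵐ ω ∂P, IsLocL2Fun (HLoc.toDist (Φ ω)) (φ ω) := by
  have h1 : ∀ᵐ ω ∂P, ∃ v : HLoc, IsLocL2Fun (HLoc.toDist v) (φ ω) ∧
      Tendsto (fun n : ℕ ↦ fieldHLoc V (2 ^ n) (2 ^ n) ω) atTop (𝓝 v) := by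
    have h2 : ∀ᵐ ω ∂P, ∀ l : ℕ+, ∃ G, Tendsto (fun n : ℕ ↦
        fieldLp V (HLoc.expo l) (2 ^ n) (2 ^ n) ω) atTop (𝓝 G) :=
      ae_all_iff.2 fun l ↦ ae_exists_tendsto_fieldLp hV (HLoc.expo l).2
    filter_upwards [h2, hφ] with ω hω hφω
    choose G hG using hω
    obtain ⟨v, hv, hlim⟩ := HLoc.exists_tendsto_of_weighted
      (u := fun n ↦ fieldHLoc V (2 ^ n) (2 ^ n) ω)
      (H := fun l n ↦ fieldLp V (HLoc.expo l) (2 ^ n) (2 ^ n) ω)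
      (fun l n ↦ fracD_fieldHLoc V _ _ _ ω) hG
    refine ⟨v, ?_, hlim⟩
    rw [hv]
    refine (weighted_isLocL2Fun (G 2)).congr ?_
    have h0 : ((HLoc.expo 2 : Set.Iio (1 / 2 : ℝ)) : ℝ) = 0 := by simp [HLoc.expo]
    have hG2 := hG 2
    rw [h0] at hG2
    -- A subsequence of the `L²` limit converges almost everywhere, which identifies it with `φ / (1
    -- + x²)`.
    obtain ⟨ns, hns, hae⟩ := (tendstoInMeasure_of_tendsto_Lp hG2).exists_seq_tendsto_ae
    have hrep : ∀ᵐ x, ∀ n : ℕ, fieldLp V 0 (2 ^ n) (2 ^ n) ω x =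
        (weight x)⁻¹ * field V 0 (2 ^ n) (2 ^ n) ω x :=
      ae_all_iff.2 fun n ↦ (memLp_field V 0 (2 ^ n) (2 ^ n) ω).coeFn_toLp
    filter_upwards [hae, hrep, hφω] with x hx hrx hφx
    have h3 : Tendsto (fun i ↦ fieldLp V 0 (2 ^ ns i) (2 ^ ns i) ω x) atTop
        (𝓝 ((weight x)⁻¹ * φ ω x)) := by
      simp_rw [hrx]
      exact (hφx.comp hns.tendsto_atTop).const_mul _
    rw [tendsto_nhds_unique hx h3, mul_inv_cancel_left₀ (weight_ne_zero x)]
  classical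
  let Φ : Ω → HLoc := fun ω ↦ if h : ∃ v : HLoc, IsLocL2Fun (HLoc.toDist v) (φ ω) ∧
      Tendsto (fun n : ℕ ↦ fieldHLoc V (2 ^ n) (2 ^ n) ω) atTop (𝓝 v) then h.choose else 0
  have hΦ : ∀ᵐ ω ∂P, IsLocL2Fun (HLoc.toDist (Φ ω)) (φ ω) ∧
      Tendsto (fun n : ℕ ↦ fieldHLoc V (2 ^ n) (2 ^ n) ω) atTop (𝓝 (Φ ω)) := by
    filter_upwards [h1] with ω hω
    simp only [Φ, dif_pos hω]
    exact hω.choose_spec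
  exact ⟨Φ, aemeasurable_of_tendsto_metrizable_ae atTop
    (fun n ↦ (measurable_fieldHLoc hV (2 ^ n) (2 ^ n)).aemeasurable) (hΦ.mono fun ω h ↦ h.2),
    hΦ.mono fun ω h ↦ h.1⟩

end Field

/-! ### Complex Gaussian variables -/

section Gaussian

variable {Ω : Type*} [MeasurableSpace Ω] {P : Measure Ω}

theorem hasLaw_re_im {X : Ω → ℂ} {v : ℝ≥0} (hX : HasLaw X (complexGaussian v) P) :
    HasLaw (fun ω ↦ ((X ω).re, (X ω).im))
      ((gaussianReal 0 (v / 2)).prod (gaussianReal 0 (v / 2))) P := by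
  have h : HasLaw (fun z : ℂ ↦ (z.re, z.im))
      ((gaussianReal 0 (v / 2)).prod (gaussianReal 0 (v / 2))) (complexGaussian v) := by
    refine ⟨by fun_prop, ?_⟩
    have hm : Measurable fun p : ℝ × ℝ ↦ (⟨p.1, p.2⟩ : ℂ) :=
      Complex.measurableEquivRealProd.symm.measurable
    rw [complexGaussian, Measure.map_map (by fun_prop) hm]
    exact Measure.map_id
  exact h.comp hX

theorem hasLaw_re {X : Ω → ℂ} {v : ℝ≥0} (hX : HasLaw X (complexGaussian v) P) :
    HasLaw (fun ω ↦ (X ω).re) (gaussianReal 0 (v / 2)) P :=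
  HasLaw.comp (X := fun ω ↦ ((X ω).re, (X ω).im)) (Y := Prod.fst)
    ⟨by fun_prop, by simp [Measure.map_fst_prod]⟩ (hasLaw_re_im hX)

theorem hasLaw_im {X : Ω → ℂ} {v : ℝ≥0} (hX : HasLaw X (complexGaussian v) P) :
    HasLaw (fun ω ↦ (X ω).im) (gaussianReal 0 (v / 2)) P :=
  HasLaw.comp (X := fun ω ↦ ((X ω).re, (X ω).im)) (Y := Prod.snd)
    ⟨by fun_prop, by simp [Measure.map_snd_prod]⟩ (hasLaw_re_im hX)

theorem indepFun_re_im [IsProbabilityMeasure P] {X : Ω → ℂ} {v : ℝ≥0}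
    (hX : HasLaw X (complexGaussian v) P) :
    IndepFun (fun ω ↦ (X ω).re) (fun ω ↦ (X ω).im) P := by
  rw [indepFun_iff_map_prod_eq_prod_map_map (hasLaw_re hX).aemeasurable (hasLaw_im hX).aemeasurable,
    (hasLaw_re_im hX).map_eq, (hasLaw_re hX).map_eq, (hasLaw_im hX).map_eq]

theorem lintegral_gaussian_sq {X : Ω → ℝ} {v : ℝ≥0} (hX : HasLaw X (gaussianReal 0 v) P) :
    ∫⁻ ω, ENNReal.ofReal (X ω ^ 2) ∂P = v := by
  have hm : MemLp (fun x : ℝ ↦ x) 2 (gaussianReal 0 v) := memLp_id_gaussianReal 2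
  have h1 : ∫ x, x ^ 2 ∂gaussianReal 0 v = v := by
    have := variance_of_integral_eq_zero (X := fun x : ℝ ↦ x) (μ := gaussianReal 0 v)
      (by fun_prop) (by simp)
    rw [variance_fun_id_gaussianReal] at this
    exact this.symm
  rw [hX.lintegral_comp (f := fun x ↦ ENNReal.ofReal (x ^ 2)) (by fun_prop),
    ← ofReal_integral_eq_lintegral_ofReal hm.integrable_sq (ae_of_all _ fun x ↦ by positivity), h1]
  simp

theorem lintegral_complexGaussian_sq {X : Ω → ℂ} {v : ℝ≥0}
    (hX : HasLaw X (complexGaussian v) P) : ∫⁻ ω, ‖X ω‖ₑ ^ 2 ∂P = v := by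
  have h1 : ∀ ω, ‖X ω‖ₑ ^ 2 = ENNReal.ofReal ((X ω).re ^ 2) + ENNReal.ofReal ((X ω).im ^ 2) :=
    fun ω ↦ by
    rw [← ofReal_norm, ← ENNReal.ofReal_pow (norm_nonneg _), Complex.sq_norm,
      Complex.normSq_apply, ← ENNReal.ofReal_add (by positivity) (by positivity), sq, sq]
  simp_rw [h1]
  rw [lintegral_add_left' (((hasLaw_re hX).aemeasurable.pow_const 2).ennreal_ofReal),
    lintegral_gaussian_sq (hasLaw_re hX), lintegral_gaussian_sq (hasLaw_im hX)]
  exact_mod_cast add_halves v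

theorem integral_complexGaussian [IsProbabilityMeasure P] {X : Ω → ℂ} {v : ℝ≥0}
    (hX : HasLaw X (complexGaussian v) P) : ∫ ω, X ω ∂P = 0 := by
  have hmem : MemLp X 2 P := ⟨hX.aemeasurable.aestronglyMeasurable, by
    have : eLpNorm X 2 P ^ 2 < ∞ := by rw [eLpNorm_two_sq, lintegral_complexGaussian_sq hX]; simp
    exact (ENNReal.pow_lt_top_iff.1 this).resolve_right (by norm_num)⟩
  have hint : Integrable X P := hmem.integrable (by norm_num)
  have hre : ∫ ω, (X ω).re ∂P = 0 := by
    rw [(hasLaw_re hX).integral_eq]; simp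
  have him : ∫ ω, (X ω).im ∂P = 0 := by
    rw [(hasLaw_im hX).integral_eq]; simp
  apply Complex.ext
  · rw [Complex.zero_re, ← hre]; exact (Complex.reCLM.integral_comp_comm hint).symm
  · rw [Complex.zero_im, ← him]; exact (Complex.imCLM.integral_comp_comm hint).symm

theorem hasLaw_re_mul [IsProbabilityMeasure P] {X : Ω → ℂ} {v : ℝ≥0}
    (hX : HasLaw X (complexGaussian v) P) (z : ℂ) :
    HasLaw (fun ω ↦ (X ω * z).re) (gaussianReal 0 (‖z‖₊ ^ 2 * (v / 2))) P := by
  have h1 := gaussianReal_mul_const (hasLaw_re hX) z.re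
  have h2 := gaussianReal_mul_const (hasLaw_im hX) (-z.im)
  have h3 : IndepFun (fun ω ↦ (X ω).re * z.re) (fun ω ↦ (X ω).im * -z.im) P :=
    (indepFun_re_im hX).comp (measurable_mul_const z.re) (measurable_mul_const (-z.im))
  have h4 := gaussianReal_add_gaussianReal_of_indepFun h3 h1.map_eq h2.map_eq
  refine ⟨by have := hX.aemeasurable; fun_prop, ?_⟩
  convert h4 using 1
  · congr 1
    funext ω
    simp [sub_eq_add_neg]
  · congr 1
    · simp
    · ext
      push_cast
      rw [Complex.sq_norm, Complex.normSq_apply]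
      ring

end Gaussian

/-! ### From Brownian motion to orthogonal increments, and existence of the field -/

/-- Only increments of `W` are known to be almost everywhere measurable, not `W t` itself. Hence a
measurable version of `W t - W 0` is taken at each time, which leaves the increments unchanged
almost surely. -/
theorem IsComplexBrownianMotion.exists_hasOrthogonalIncrements {Ω : Type*} [MeasurableSpace Ω]
    {P : Measure Ω} [IsProbabilityMeasure P] {W : ℝ → Ω → ℂ} (hW : IsComplexBrownianMotion W P) :
    ∃ V : ℝ → Ω → ℂ, HasOrthogonalIncrements V P ∧
      ∀ t, V t =ᵐ[P] fun ω ↦ W t ω - W 0 ω := by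
  have hm : ∀ t, AEMeasurable (fun ω ↦ W t ω - W 0 ω) P := fun t ↦ by
    rcases le_total 0 t with h | h
    · exact (hW.hasLaw_sub 0 t h).aemeasurable
    · have := (hW.hasLaw_sub t 0 h).aemeasurable.neg
      refine this.congr (ae_of_all _ fun ω ↦ ?_)
      simp
  have hV : ∀ t, (hm t).mk _ =ᵐ[P] fun ω ↦ W t ω - W 0 ω := fun t ↦ (hm t).ae_eq_mk.symm
  have hsub : ∀ s t, (fun ω ↦ (hm t).mk _ ω - (hm s).mk _ ω) =ᵐ[P] fun ω ↦ W t ω - W s ω :=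
    fun s t ↦ by
    filter_upwards [hV s, hV t] with ω h1 h2
    rw [h1, h2]
    ring
  refine ⟨fun t ↦ (hm t).mk _, ⟨fun t ↦ (hm t).measurable_mk, fun s t hst ↦ ?_,
    fun s t u v hst htu huv ↦ ?_⟩, hV⟩
  · rw [lintegral_congr_ae ((hsub s t).mono fun ω h ↦ by
      simpa using congrArg (fun z : ℂ ↦ ‖z‖ₑ ^ 2) h),
      lintegral_complexGaussian_sq (hW.hasLaw_sub s t hst)]
    rfl
  · have hlaw := hW.hasLaw_sub u v huv
    have hlaw' := hW.hasLaw_sub s t hst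
    -- A monotone sequence of times, constant from `v` on, whose increments `0` and `2` are the two
    -- in question.
    let τ : ℕ → ℝ
      | 0 => s
      | 1 => t
      | 2 => u
      | _ => v
    have hτ : Monotone τ := monotone_nat_of_le_succ fun n ↦ by
      match n with
      | 0 => exact hst
      | 1 => exact htu
      | 2 => exact huv
      | _ + 3 => exact le_rfl
    have hind : IndepFun (fun ω ↦ W v ω - W u ω) (fun ω ↦ W t ω - W s ω) P :=
      (hW.indep.nat hτ).indepFun (by norm_num : (2 : ℕ) ≠ 0)
    have hind' : IndepFun (fun ω ↦ W v ω - W u ω)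
        (fun ω ↦ (starRingEnd ℂ) (W t ω - W s ω)) P :=
      hind.comp measurable_id Complex.continuous_conj.measurable
    have e : ∫ ω, ((hm v).mk _ ω - (hm u).mk _ ω) *
        (starRingEnd ℂ) ((hm t).mk _ ω - (hm s).mk _ ω) ∂P =
        ∫ ω, (W v ω - W u ω) * (starRingEnd ℂ) (W t ω - W s ω) ∂P := by
      refine integral_congr_ae ?_
      filter_upwards [hsub u v, hsub s t] with ω h1 h2
      rw [h1, h2]
    rw [e, hind'.integral_fun_mul_eq_mul_integral hlaw.aemeasurable.aestronglyMeasurable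
      (Complex.continuous_conj.measurable.comp_aemeasurable
        hlaw'.aemeasurable).aestronglyMeasurable, integral_complexGaussian hlaw, zero_mul]

theorem approxField_congr {Ω : Type*} {V W : ℝ → Ω → ℂ} {ω : Ω}
    (h : ∀ (n : ℕ) (k : ℤ), V ((k : ℝ) / (2 ^ n : ℕ)) ω = W ((k : ℝ) / (2 ^ n : ℕ)) ω - W 0 ω)
    (n R : ℕ) (x : ℝ) : approxField V (2 ^ n) R ω x = approxField W (2 ^ n) R ω x := by
  refine Finset.sum_congr rfl fun k _ ↦ ?_
  have h1 := h n (k + 1)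
  rw [Int.cast_add, Int.cast_one] at h1
  rw [h1, h n k, sub_sub_sub_cancel_right]

theorem exists_isRandomField {Ω : Type*} [MeasurableSpace Ω] (P : Measure Ω)
    [IsProbabilityMeasure P] (W : ℝ → Ω → ℂ) (hW : IsComplexBrownianMotion W P) :
    ∃ Φ : Ω → HLoc, IsRandomField W P Φ := by
  obtain ⟨V, hV, hVW⟩ := hW.exists_hasOrthogonalIncrements
  obtain ⟨φ, ⟨hφm, ψ, hψm, hψ, hφ⟩, hlim⟩ := exists_isLimitField hV
  obtain ⟨Φ, hΦ, hrep⟩ := exists_hLoc_version hV hlim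
  -- The approximations use dyadic times only, so countably many null sets suffice.
  have hdy : ∀ᵐ ω ∂P, ∀ (n : ℕ) (k : ℤ), V ((k : ℝ) / (2 ^ n : ℕ)) ω =
      W ((k : ℝ) / (2 ^ n : ℕ)) ω - W 0 ω :=
    ae_all_iff.2 fun n ↦ ae_all_iff.2 fun k ↦ hVW _
  refine ⟨Φ, hΦ, φ, ⟨hφm, ψ, hψm, fun R ↦ (hψ R).congr fun n ↦ ?_, hφ⟩, hrep⟩
  refine weightedNorm_congr (hdy.mono fun ω hω x ↦ ?_)
  rw [approxField_congr hω]

/-! ### Small ball probabilities -/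

section SmallBall

variable {Ω : Type*} [MeasurableSpace Ω] {P : Measure Ω}

theorem hasLaw_sum_gaussianReal [IsProbabilityMeasure P] {X : ℕ → Ω → ℝ} {v : ℕ → ℝ≥0}
    (hX : ∀ i, HasLaw (X i) (gaussianReal 0 (v i)) P) (hi : iIndepFun X P) (n : ℕ) :
    HasLaw (∑ i ∈ Finset.range n, X i) (gaussianReal 0 (∑ i ∈ Finset.range n, v i)) P := by
  induction n with
  | zero =>
    simp only [Finset.range_zero, Finset.sum_empty, gaussianReal_zero_var]
    exact hasLaw_dirac_of_ae_eq (ae_of_all _ fun _ ↦ rfl)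
  | succ n ih =>
    rw [Finset.sum_range_succ, Finset.sum_range_succ]
    refine ⟨ih.aemeasurable.add (hX n).aemeasurable, ?_⟩
    have := gaussianReal_add_gaussianReal_of_indepFun
      (hi.indepFun_finsetSum_of_notMem₀ (fun i ↦ (hX i).aemeasurable)
        (Finset.notMem_range_self (n := n))) ih.map_eq (hX n).map_eq
    rwa [add_zero] at this

/-- With variance at least `1/2` the density is at most `1 / √π`, hence at most `1`. -/
theorem gaussianReal_Icc_le {v : ℝ≥0} (hv : 1 / 2 ≤ v) (r : ℝ) :
    gaussianReal 0 v (Set.Icc (-r) r) ≤ ENNReal.ofReal (2 * r) := by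
  have hv' : (1 / 2 : ℝ) ≤ v := by exact_mod_cast hv
  have hv0 : v ≠ 0 := by
    rintro rfl
    norm_num at hv'
  rw [gaussianReal_apply _ hv0]
  calc ∫⁻ x in Set.Icc (-r) r, gaussianPDF 0 v x ≤ ∫⁻ _ in Set.Icc (-r) r, 1 := by
        refine lintegral_mono fun x ↦ ?_
        rw [gaussianPDF, ← ENNReal.ofReal_one, gaussianPDFReal]
        refine ENNReal.ofReal_le_ofReal (mul_le_one₀ (inv_le_one_of_one_le₀ ?_) (by positivity) ?_)
        · refine Real.one_le_sqrt.2 ?_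
          nlinarith [Real.pi_gt_three]
        · rw [Real.exp_le_one_iff]
          exact div_nonpos_of_nonpos_of_nonneg (by nlinarith [sq_nonneg (x - 0)]) (by positivity)
    _ = ENNReal.ofReal (2 * r) := by
        rw [setLIntegral_const, one_mul, Real.volume_Icc]
        congr 1
        ring

theorem sum_Ico_eq_sum_range {M : Type*} [AddCommMonoid M] (F : ℤ → M) (n : ℕ) :
    ∑ k ∈ Finset.Ico (-(n : ℤ)) n, F k = ∑ i ∈ Finset.range (2 * n), F ((i : ℤ) - n) := by
  refine Finset.sum_nbij' (fun k ↦ (k + n).toNat) (fun i ↦ (i : ℤ) - n) ?_ ?_ ?_ ?_ ?_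
  · intro k hk; simp only [Finset.mem_Ico, Finset.mem_range] at *; omega
  · intro k hk; simp only [Finset.mem_Ico, Finset.mem_range] at *; omega
  · intro k hk; simp only [Finset.mem_Ico] at *; omega
  · intro k hk; simp only [Finset.mem_range] at *; omega
  · intro k hk
    simp only [Finset.mem_Ico] at hk
    congr 1
    omega

/-- The variance of the real part of the approximating field is at least `1 / 2`. -/
theorem half_le_sum_norm_profile_sq {N R : ℕ} (hN : N ≠ 0) (hR : R ≠ 0) (x : ℝ) :
    (1 / 2 : ℝ) ≤ ∑ k ∈ Finset.Ico (-((N * R : ℕ) : ℤ)) ((N * R : ℕ) : ℤ),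
      ‖profile 0 x ((k : ℝ) / N)‖ ^ 2 * (1 / N / 2) := by
  have hN0 : (0 : ℝ) < N := by exact_mod_cast Nat.pos_of_ne_zero hN
  have hle : N ≤ N * R := Nat.le_mul_of_pos_right N (Nat.pos_of_ne_zero hR)
  -- Only the `2N` cells with `|κ| ≤ 1` are kept. There the squared profile is at least `1/2`, and
  -- each real part carries the variance `1 / (2N)`.
  calc (1 / 2 : ℝ) = ∑ k ∈ Finset.Ico (-(N : ℤ)) (N : ℤ), (1 / 2 : ℝ) * (1 / N / 2) := by
        rw [Finset.sum_const, Int.card_Ico, nsmul_eq_mul,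
          show ((N : ℤ) - -(N : ℤ)).toNat = 2 * N by omega]
        push_cast
        field_simp
    _ ≤ ∑ k ∈ Finset.Ico (-(N : ℤ)) (N : ℤ), ‖profile 0 x ((k : ℝ) / N)‖ ^ 2 * (1 / N / 2) := by
        refine Finset.sum_le_sum fun k hk ↦ ?_
        gcongr
        rw [norm_profile_sq, zero_sub, Real.rpow_neg_one, one_div]
        refine inv_anti₀ (by positivity) ?_
        have h1 : |(k : ℝ) / N| ≤ 1 := by
          rw [abs_div, abs_of_pos hN0, div_le_one hN0, abs_le]
          have := Finset.mem_Ico.1 hk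
          constructor
          · exact_mod_cast this.1
          · exact_mod_cast this.2.le
        have := (sq_le_one_iff_abs_le_one _).2 h1
        linarith
    _ ≤ _ := by
        refine Finset.sum_le_sum_of_subset_of_nonneg ?_ fun _ _ _ ↦ by positivity
        apply Finset.Ico_subset_Ico <;> omega

theorem IsComplexBrownianMotion.measure_approxField_le [IsProbabilityMeasure P] {W : ℝ → Ω → ℂ}
    (hW : IsComplexBrownianMotion W P) {N R : ℕ} (hN : N ≠ 0) (hR : R ≠ 0) (x r : ℝ) :
    P {ω | ‖approxField W N R ω x‖ ≤ r} ≤ ENNReal.ofReal (2 * r) := by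
  have hN0 : (0 : ℝ) < N := by exact_mod_cast Nat.pos_of_ne_zero hN
  set n := N * R with hn
  -- The grid is shifted by `n` to be indexed by `ℕ`, the form in which independence of increments
  -- gives an independent family.
  set κ : ℕ → ℝ := fun i ↦ (((i : ℤ) - n : ℤ) : ℝ) / N with hκ
  have hκs : ∀ i, κ (i + 1) = ((((i : ℤ) - n : ℤ) : ℝ) + 1) / N := fun i ↦ by
    simp only [hκ]
    push_cast
    ring
  have hmono : Monotone κ := monotone_nat_of_le_succ fun i ↦ by
    rw [hκs]
    simp only [hκ]
    gcongr
    linarith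
  set v : ℕ → ℝ≥0 := fun i ↦ ‖profile 0 x (κ i)‖₊ ^ 2 * ((κ (i + 1) - κ i).toNNReal / 2)
  set X : ℕ → Ω → ℝ := fun i ω ↦ ((W (κ (i + 1)) ω - W (κ i) ω) * profile 0 x (κ i)).re
  have hX : ∀ i, HasLaw (X i) (gaussianReal 0 (v i)) P := fun i ↦
    hasLaw_re_mul (hW.hasLaw_sub _ _ (hmono i.le_succ)) _
  have hi : iIndepFun X P := (hW.indep.nat hmono).comp (fun i z ↦ (z * profile 0 x (κ i)).re)
    fun i ↦ by fun_prop
  have hlaw := hasLaw_sum_gaussianReal hX hi (2 * n)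
  have hre : ∀ ω, (approxField W N R ω x).re = (∑ i ∈ Finset.range (2 * n), X i) ω := fun ω ↦ by
    rw [approxField_eq_field, field, ← hn, sum_Ico_eq_sum_range, Complex.re_sum, Finset.sum_apply]
    refine Finset.sum_congr rfl fun i _ ↦ ?_
    simp only [X, hκs]
    rfl
  have hv : 1 / 2 ≤ ∑ i ∈ Finset.range (2 * n), v i := by
    have h1 := half_le_sum_norm_profile_sq hN hR x
    rw [← hn, sum_Ico_eq_sum_range] at h1
    rw [← NNReal.coe_le_coe]
    push_cast
    refine h1.trans (le_of_eq (Finset.sum_congr rfl fun i _ ↦ ?_))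
    have h2 : κ (i + 1) - κ i = 1 / N := by
      rw [hκs]
      simp only [hκ]
      ring
    simp only [v, h2]
    push_cast
    rw [Real.coe_toNNReal _ (by positivity)]
    simp only [hκ]
    push_cast
    rfl
  calc P {ω | ‖approxField W N R ω x‖ ≤ r}
      ≤ P {ω | (∑ i ∈ Finset.range (2 * n), X i) ω ∈ Set.Icc (-r) r} := by
        refine measure_mono fun ω hω ↦ ?_
        rw [Set.mem_ofPred_eq, ← hre, Set.mem_Icc, ← abs_le]
        exact (Complex.abs_re_le_norm _).trans hω
    _ = gaussianReal 0 (∑ i ∈ Finset.range (2 * n), v i) (Set.Icc (-r) r) := by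
        rw [← hlaw.map_eq, Measure.map_apply_of_aemeasurable hlaw.aemeasurable measurableSet_Icc]
        rfl
    _ ≤ _ := gaussianReal_Icc_le hv r

/-! ### Passage to the limit and failure of square integrability -/

theorem aestronglyMeasurable_slice [IsProbabilityMeasure P] {f : Ω → ℝ → ℂ}
    (hf : AEStronglyMeasurable (Function.uncurry f) (P.prod volume)) :
    ∀ᵐ x, AEStronglyMeasurable (fun ω ↦ f ω x) P :=
  hf.prod_swap.prodMk_left

theorem aestronglyMeasurable_approxField {W : ℝ → Ω → ℂ} (hW : IsComplexBrownianMotion W P)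
    (N R : ℕ) (x : ℝ) : AEStronglyMeasurable (fun ω ↦ approxField W N R ω x) P := by
  refine Finset.aestronglyMeasurable_fun_sum _ fun k _ ↦ ?_
  refine AEStronglyMeasurable.mul_const ?_ _
  refine AEStronglyMeasurable.mul_const ?_ _
  refine (hW.hasLaw_sub _ _ ?_).aemeasurable.aestronglyMeasurable
  gcongr
  linarith

theorem ae_tendsto_eLpNorm_of_weightedNorm {f : ℕ → Ω → ℝ → ℂ}
    (h : Tendsto (fun n ↦ weightedNorm P (f n)) atTop (𝓝 0)) :
    ∀ᵐ x, Tendsto (fun n ↦ eLpNorm (fun ω ↦ f n ω x) 2 P) atTop (𝓝 0) := by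
  have h1 : ∀ᵐ x : ℝ, ∀ n, ENNReal.ofReal (√(1 + x ^ 2))⁻¹ * eLpNorm (fun ω ↦ f n ω x) 2 P ≤
      weightedNorm P (f n) := ae_all_iff.2 fun n ↦ ENNReal.ae_le_essSup _
  filter_upwards [h1] with x hx
  have hpos : 0 < √(1 + x ^ 2) := Real.sqrt_pos.2 (by positivity)
  have h2 : ∀ n, eLpNorm (fun ω ↦ f n ω x) 2 P ≤
      ENNReal.ofReal (√(1 + x ^ 2)) * weightedNorm P (f n) := fun n ↦ by
    refine le_trans (le_of_eq ?_) (mul_le_mul_right (hx n) _)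
    rw [← mul_assoc, ← ENNReal.ofReal_mul hpos.le, mul_inv_cancel₀ hpos.ne']
    simp
  have h3 := ENNReal.Tendsto.const_mul (a := ENNReal.ofReal (√(1 + x ^ 2))) h
    (Or.inr ENNReal.ofReal_ne_top)
  rw [mul_zero] at h3
  exact tendsto_of_tendsto_of_tendsto_of_le_of_le tendsto_const_nhds h3 (fun _ ↦ zero_le) h2

/-- If `g` is in the small ball and `f n` is outside the larger one, they differ by at least `r' -
r`, which has vanishing probability by convergence in measure. The gap between the radii is what
makes this work. -/
theorem measure_norm_le_of_tendsto {f : ℕ → Ω → ℂ} {g : Ω → ℂ}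
    (hf : ∀ n, AEStronglyMeasurable (f n) P) (hg : AEStronglyMeasurable g P)
    (h : Tendsto (fun n ↦ eLpNorm (fun ω ↦ f n ω - g ω) 2 P) atTop (𝓝 0)) {r r' : ℝ} (hr : r < r')
    {b : ℝ≥0∞} (hb : ∀ᶠ n in atTop, P {ω | ‖f n ω‖ ≤ r'} ≤ b) : P {ω | ‖g ω‖ ≤ r} ≤ b := by
  have h1 := tendstoInMeasure_of_tendsto_eLpNorm (by norm_num) hf hg h
  rw [tendstoInMeasure_iff_norm] at h1
  have h2 := (h1 (r' - r) (by linarith)).const_add b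
  rw [add_zero] at h2
  refine ge_of_tendsto h2 ?_
  filter_upwards [hb] with n hn
  refine (measure_mono fun ω hω ↦ ?_).trans ((measure_union_le _ _).trans (add_le_add_left hn _))
  by_cases hc : ‖f n ω‖ ≤ r'
  · exact Or.inl hc
  · refine Or.inr ?_
    have h3 : ‖g ω‖ ≤ r := hω
    have := norm_sub_norm_le (f n ω) (g ω)
    simp only [Set.mem_ofPred_eq]
    linarith [not_le.1 hc]

theorem IsLimitField.ae_measure_norm_le [IsProbabilityMeasure P] {W : ℝ → Ω → ℂ}
    (hW : IsComplexBrownianMotion W P) {φ : Ω → ℝ → ℂ} (hφ : IsLimitField W P φ) :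
    ∀ᵐ x, ∀ r : ℝ, 0 < r → P {ω | ‖φ ω x‖ ≤ r} ≤ ENNReal.ofReal (6 * r) := by
  obtain ⟨hm, ψ, hψm, hψ, hlim⟩ := hφ
  filter_upwards [aestronglyMeasurable_slice hm,
    ae_all_iff.2 fun R ↦ aestronglyMeasurable_slice (hψm R),
    ae_all_iff.2 fun R ↦ ae_tendsto_eLpNorm_of_weightedNorm (hψ R),
    ae_tendsto_eLpNorm_of_weightedNorm hlim] with x h1 h2 h3 h4 r hr
  -- Each of the two limits enlarges the radius, `r` to `2r` to `3r`, and `2 · 3r` gives the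
  -- constant `6`.
  refine measure_norm_le_of_tendsto h2 h1 h4 (r' := 2 * r) (by linarith) ?_
  filter_upwards [eventually_ne_atTop 0] with R hR
  refine measure_norm_le_of_tendsto (fun n ↦ aestronglyMeasurable_approxField hW (2 ^ n) R x)
    (h2 R) (h3 R) (r' := 3 * r) (by linarith) (Eventually.of_forall fun n ↦ ?_)
  have := hW.measure_approxField_le (N := 2 ^ n) (by positivity) hR x (3 * r)
  rwa [show 2 * (3 * r) = 6 * r by ring] at this

/-- A random field whose values do not concentrate at zero, uniformly in space, is almost surely
not square integrable on the line. -/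
theorem ae_lintegral_eq_top [IsProbabilityMeasure P] {φ : Ω → ℝ → ℂ}
    (hm : AEStronglyMeasurable (Function.uncurry φ) (P.prod volume))
    (h : ∀ᵐ x, ∀ r : ℝ, 0 < r → P {ω | ‖φ ω x‖ ≤ r} ≤ ENNReal.ofReal (6 * r)) :
    ∀ᵐ ω ∂P, ∫⁻ x, ‖φ ω x‖ₑ ^ 2 = ∞ := by
  have hsq : AEMeasurable (fun p : Ω × ℝ ↦ ‖φ p.1 p.2‖ₑ ^ 2) (P.prod volume) :=
    hm.enorm.pow_const 2
  have hI : AEMeasurable (fun ω ↦ ∫⁻ x, ‖φ ω x‖ₑ ^ 2) P := hsq.lintegral_prod_right'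
  have key : ∀ C : ℕ, P {ω | ∫⁻ x, ‖φ ω x‖ₑ ^ 2 ≤ C} = 0 := fun C ↦ by
    set A := {ω | ∫⁻ x, ‖φ ω x‖ₑ ^ 2 ≤ C} with hA
    by_contra hp
    have hAm : NullMeasurableSet A P := nullMeasurableSet_le hI aemeasurable_const
    set p := (P A).toReal with hpdef
    have hp0 : 0 < p := ENNReal.toReal_pos hp (measure_ne_top P A)
    have hpA : P A = ENNReal.ofReal p := (ENNReal.ofReal_toReal (measure_ne_top P A)).symm
    -- At radius `p / 12` the small ball has probability at most `p / 2`, so at least half of `A`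
    -- lies outside it, for almost every `x`.
    have hr : 0 < p / 12 := by positivity
    have hlow : ∀ᵐ x, ENNReal.ofReal (p / 12) ^ 2 * ENNReal.ofReal (p / 2) ≤
        ∫⁻ ω in A, ‖φ ω x‖ₑ ^ 2 ∂P := by
      filter_upwards [h, aestronglyMeasurable_slice hm] with x hx hxm
      have h1 : ENNReal.ofReal (p / 2) ≤ P (A \ {ω | ‖φ ω x‖ ≤ p / 12}) := by
        refine le_trans ?_ (le_measure_sdiff)
        refine le_trans ?_ (tsub_le_tsub_left (hx _ hr) _)
        rw [hpA, ← ENNReal.ofReal_sub _ (by positivity)]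
        refine ENNReal.ofReal_le_ofReal ?_
        linarith
      calc _ ≤ ENNReal.ofReal (p / 12) ^ 2 * P (A \ {ω | ‖φ ω x‖ ≤ p / 12}) := by gcongr
        _ = ENNReal.ofReal (p / 12) ^ 2 * P ({ω | ‖φ ω x‖ ≤ p / 12}ᶜ ∩ A) := by
            rw [Set.sdiff_eq, Set.inter_comm]
        _ ≤ ENNReal.ofReal (p / 12) ^ 2 *
            (P.restrict A) {ω | ENNReal.ofReal (p / 12) ^ 2 ≤ ‖φ ω x‖ₑ ^ 2} := by
            refine mul_le_mul_right ((Measure.le_restrict_apply A _).trans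
              (measure_mono fun ω hω ↦ ?_)) _
            have h2 : p / 12 < ‖φ ω x‖ := not_le.1 hω
            simp only [Set.mem_ofPred_eq]
            gcongr
            rw [← ofReal_norm]
            exact ENNReal.ofReal_le_ofReal h2.le
        _ ≤ _ := mul_meas_ge_le_lintegral₀ (hxm.enorm.pow_const 2).restrict _
    have hup : ∫⁻ x, ∫⁻ ω in A, ‖φ ω x‖ₑ ^ 2 ∂P ≤ C := by
      have hsqA : AEMeasurable (fun p : ℝ × Ω ↦ ‖φ p.2 p.1‖ₑ ^ 2) (volume.prod (P.restrict A)) := by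
        have e : (volume : Measure ℝ).prod (P.restrict A) =
            (volume.prod P).restrict (Set.univ ×ˢ A) := by
          rw [← Measure.prod_restrict, Measure.restrict_univ]
        rw [e]
        exact (hm.prod_swap.enorm.pow_const 2).restrict
      rw [lintegral_lintegral_swap hsqA]
      calc _ ≤ ∫⁻ ω in A, (C : ℝ≥0∞) ∂P := by
            refine lintegral_mono_ae ?_
            filter_upwards [ae_restrict_mem₀ hAm] with ω hω using hω
        _ ≤ C := by
            rw [setLIntegral_const]
            exact mul_le_of_le_one_right zero_le prob_le_one
    have htop : ∫⁻ _ : ℝ, ENNReal.ofReal (p / 12) ^ 2 * ENNReal.ofReal (p / 2) = ∞ := by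
      rw [lintegral_const, Real.volume_univ, ENNReal.mul_top]
      simp [hp0]
    have := (lintegral_mono_ae hlow).trans hup
    rw [htop] at this
    exact ENNReal.natCast_ne_top C (top_le_iff.1 this)
  have hall : ∀ᵐ ω ∂P, ∀ C : ℕ, ¬ ∫⁻ x, ‖φ ω x‖ₑ ^ 2 ≤ C :=
    ae_all_iff.2 fun C ↦ by
      rw [ae_iff]
      simpa using key C
  filter_upwards [hall] with ω hω
  by_contra hne
  obtain ⟨C, hC⟩ := ENNReal.exists_nat_gt hne
  exact hω C hC.le

theorem ae_notMem_squareIntegrable [IsProbabilityMeasure P] {W : ℝ → Ω → ℂ}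
    (hW : IsComplexBrownianMotion W P) {Φ : Ω → HLoc} (hΦ : IsRandomField W P Φ) :
    ∀ᵐ ω ∂P, Φ ω ∉ squareIntegrable := by
  obtain ⟨-, φ, hφ, hrep⟩ := hΦ
  filter_upwards [hrep, ae_lintegral_eq_top hφ.1 (hφ.ae_measure_norm_le hW)] with ω h1 h2 h3
  have h4 : MemLp (HLoc.toFun (Φ ω)) 2 volume := h3
  have h5 : MemLp (φ ω) 2 volume := (memLp_congr_ae (HLoc.toFun_ae_eq h1)).1 h4
  have h6 := eLpNorm_two_sq volume (φ ω)
  rw [h2] at h6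
  exact (ENNReal.pow_ne_top h5.2.ne) h6

end SmallBall

end KleinGordon

theorem mainTheorem7 {Ω : Type*} [MeasurableSpace Ω] (P : Measure Ω) [IsProbabilityMeasure P]
    (W : ℝ → Ω → ℂ) (hW : KleinGordon.IsComplexBrownianMotion W P) :
    (∃ Φ : Ω → KleinGordon.HLoc, KleinGordon.IsRandomField W P Φ) ∧
    ∀ Φ : Ω → KleinGordon.HLoc, KleinGordon.IsRandomField W P Φ →
      (∀ᵐ ω ∂P, Φ ω ∉ KleinGordon.squareIntegrable) ∧
      P.map Φ KleinGordon.squareIntegrable = 0 ∧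
      ∀ χ : ℝ → ℝ, KleinGordon.IsAdmissibleWeight χ →
        KleinGordon.gibbsMeasure χ (P.map Φ) KleinGordon.squareIntegrable = 0 := by
  refine ⟨KleinGordon.exists_isRandomField P W hW, fun Φ hΦ ↦ ?_⟩
  have h1 := KleinGordon.ae_notMem_squareIntegrable hW hΦ
  have h2 : P.map Φ KleinGordon.squareIntegrable = 0 := by
    rw [Measure.map_apply_of_aemeasurable hΦ.1 KleinGordon.HLoc.measurableSet_squareIntegrable]
    exact measure_mono_null (fun ω hω ↦ not_not.2 hω) (ae_iff.1 h1)
  refine ⟨h1, h2, fun χ _ ↦ ?_⟩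
  -- No bound on `Γ` is needed: even an infinite factor `Γ⁻¹` times `0` is `0`.
  rw [KleinGordon.gibbsMeasure, Measure.smul_apply,
    withDensity_absolutelyContinuous _ _ h2, smul_zero]
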